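/- Let $\mathbb A^2=\operatorname{Spec}\mathbb C[t_1,t_2]$ with the standard action $(s_1,s_2)\cdot(t_1,t_2)=(s_1t_1,s_2t_2)$ of the torus $\mathbb G_m^2$. Let $E$ be a $\mathbb G_m^2$-equivariant algebraic vector bundle of rank $r$ on $\mathbb A^2$, and let $\nabla:E\to \Omega^1_{\mathbb A^2}\otimes E$ be a $\mathbb G_m^2$-equivariant algebraic connection, not necessarily flat. Let $\check{\mathbb P}^2=\operatorname{Proj}\mathbb C[v_0,v_1,v_2]$ be the dual projective plane, where $[v_0:v_1:v_2]$ corresponds to the line $v_0+v_1t_1+v_2t_2=0$, and let $\check{\mathbb P}^2_0=\check{\mathbb P}^2\setminus\{[1:0:0]\}$ be the variety of lines in $\mathbb A^2$. Let $Q_0\subset \mathbb A^2\times\check{\mathbb P}^2_0$ be the incidence variety $v_0+v_1t_1+v_2t_2=0$ of pairs (point, line through it), with projections $q_0:Q_0\to\mathbb A^2$ and $p_0:Q_0\to\check{\mathbb P}^2_0$. The connection $\nabla$ induces a relative connection $q_0^*E\to q_0^*E\otimes\Omega^1_{Q_0/\check{\mathbb P}^2_0}$ along the fibres of $p_0$.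 Let $$\mathcal E^0=p_{0*}^{\nabla}(q_0^*E)\subset p_{0*}q_0^*E$$ be the subsheaf of $\mathcal O_{\check{\mathbb P}^2_0}$-modules consisting of the sections that are covariantly constant along the fibres of $p_0$, i.e. annihilated by this relative connection. Then $\mathcal E^0$ is locally free of rank $r$, so it is an algebraic vector bundle of rank $r$ on $\check{\mathbb P}^2_0$. -/

import Mathlib

namespace RadonPenrose

noncomputable section

open CategoryTheory AlgebraicGeometry MvPolynomial TensorProduct Opposite

/-- The coordinate ring `ℂ[t₁, t₂]` of the affine plane; `t₁ = X 0` and `t₂ = X 1`. -/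
abbrev PlaneRing : Type := MvPolynomial (Fin 2) ℂ

/-- The affine plane `𝔸²` over `ℂ`. -/
abbrev Plane : Scheme.{0} := Spec (CommRingCat.of PlaneRing)

/-- Polynomial rings carry the standard grading by total degree. -/
instance homogeneousGradedAlgebra (σ R : Type) [CommRing R] :
    GradedAlgebra (homogeneousSubmodule σ R) := MvPolynomial.gradedAlgebra

/-- The standard grading of `ℂ[v₀, v₁, v₂]`. -/
abbrev dualGrading : ℕ → Submodule ℂ (MvPolynomial (Fin 3) ℂ) := homogeneousSubmodule (Fin 3) ℂ

/-- The dual projective plane `Proj ℂ[v₀, v₁, v₂]`. The point `[v₀ : v₁ : v₂]` is the line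
`v₀ + v₁ t₁ + v₂ t₂ = 0`. -/
abbrev DualPlane : Scheme.{0} := Proj dualGrading

/-- The complement of the point `[1 : 0 : 0]` (the line at infinity), which is the common zero of
`v₁` and `v₂`. -/
def puncturedOpen : DualPlane.Opens :=
  Proj.basicOpen dualGrading (X 1) ⊔ Proj.basicOpen dualGrading (X 2)

/-- The punctured dual plane, whose points are the lines of `𝔸²`. -/
abbrev PuncturedDualPlane : Scheme.{0} := puncturedOpen.toScheme

/-- The standard grading of `ℂ[t₁, t₂][v₁, v₂]`; here `v₁ = X 0` and `v₂ = X 1`. -/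
abbrev incidenceGrading : ℕ → Submodule PlaneRing (MvPolynomial (Fin 2) PlaneRing) :=
  homogeneousSubmodule (Fin 2) PlaneRing

/-- The incidence variety `Q₀` of pairs (point of `𝔸²`, line through it). Inside
`𝔸² × Proj ℂ[v₀, v₁, v₂] = Proj R[v₀, v₁, v₂]`, `R = ℂ[t₁, t₂]`, it is the zero locus of
`v₀ + t₁ v₁ + t₂ v₂`, that is `Proj (R[v₀, v₁, v₂] / (v₀ + t₁ v₁ + t₂ v₂))`; elimination of `v₀`
identifies this graded quotient ring with `R[v₁, v₂]`, see `aeval_lineCoord_surjective` and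
`ker_aeval_lineCoord`. -/
abbrev Incidence : Scheme.{0} := Proj incidenceGrading

/-- The coordinates `(v₀, v₁, v₂) = (-(t₁ v₁ + t₂ v₂), v₁, v₂)` of the universal line through the
point `(t₁, t₂)`. -/
def lineCoord : Fin 3 → MvPolynomial (Fin 2) PlaneRing :=
  ![-(C (X 0) * X 0 + C (X 1) * X 1), X 0, X 1]

theorem lineCoord_isHomogeneous (i : Fin 3) : (lineCoord i).IsHomogeneous 1 := by
  fin_cases i
  · refine IsHomogeneous.neg (IsHomogeneous.add ?_ ?_)
    · simpa using (isHomogeneous_C (Fin 2) (X 0 : PlaneRing)).mul (isHomogeneous_X PlaneRing 0)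
    · simpa using (isHomogeneous_C (Fin 2) (X 1 : PlaneRing)).mul (isHomogeneous_X PlaneRing 1)
  · exact isHomogeneous_X _ _
  · exact isHomogeneous_X _ _

/-- The graded homomorphism `ℂ[v₀, v₁, v₂] → ℂ[t₁, t₂][v₁, v₂]` with values `lineCoord`. -/
def lineHom : dualGrading →+*ᵍ incidenceGrading where
  toRingHom := (aeval lineCoord : MvPolynomial (Fin 3) ℂ →ₐ[ℂ] _).toRingHom
  map_mem {i x} hx := by
    have h := IsHomogeneous.aeval (R := ℂ) hx lineCoord lineCoord_isHomogeneous
    simpa using h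

/-- `R[v₁, v₂]` is a quotient of `R[v₀, v₁, v₂]`. -/
theorem aeval_lineCoord_surjective : Function.Surjective
    (aeval lineCoord : MvPolynomial (Fin 3) PlaneRing →ₐ[PlaneRing] _) := by
  intro x
  refine ⟨aeval ![X 1, X 2] x, ?_⟩
  rw [← AlgHom.comp_apply]
  conv_rhs => rw [← AlgHom.id_apply (R := PlaneRing) x]
  congr 1
  ext i : 1
  fin_cases i <;> simp [lineCoord]

/-- The kernel of `R[v₀, v₁, v₂] → R[v₁, v₂]` is generated by the equation of the incidence relation. -/
theorem ker_aeval_lineCoord :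
    RingHom.ker (aeval lineCoord : MvPolynomial (Fin 3) PlaneRing →ₐ[PlaneRing] _) =
      Ideal.span {X 0 + C (X 0) * X 1 + C (X 1) * X 2} := by
  apply le_antisymm
  · intro x hx
    have key : (Ideal.Quotient.mkₐ PlaneRing (Ideal.span
        {(X 0 + C (X 0) * X 1 + C (X 1) * X 2 : MvPolynomial (Fin 3) PlaneRing)})) =
        ((Ideal.Quotient.mkₐ PlaneRing (Ideal.span
        {(X 0 + C (X 0) * X 1 + C (X 1) * X 2 : MvPolynomial (Fin 3) PlaneRing)})).comp
          (aeval ![X 1, X 2])).comp (aeval lineCoord) := by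
      ext i : 1
      fin_cases i
      · simp only [AlgHom.comp_apply, Ideal.Quotient.mkₐ_eq_mk, aeval_X]
        rw [Ideal.Quotient.eq]
        refine Ideal.subset_span ?_
        simp [lineCoord, algebraMap_eq]
        ring
      · simp [lineCoord]
      · simp [lineCoord]
    rw [← Ideal.Quotient.eq_zero_iff_mem, ← Ideal.Quotient.mkₐ_eq_mk PlaneRing, key]
    rw [AlgHom.comp_apply, (RingHom.mem_ker).mp hx, map_zero]
  · rw [Ideal.span_singleton_le_iff_mem, RingHom.mem_ker]
    simp [lineCoord, algebraMap_eq]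

theorem irrelevant_incidence_le :
    (HomogeneousIdeal.irrelevant incidenceGrading).toIdeal ≤
      Ideal.span (Set.range (X : Fin 2 → MvPolynomial (Fin 2) PlaneRing)) := by
  rw [HomogeneousIdeal.toIdeal_irrelevant_le]
  intro n hn x hx
  rw [← Set.image_univ]
  refine mem_ideal_span_X_image.mpr fun m hm => ?_
  have hd : m.degree = n := by
    have := (show x.IsHomogeneous n from hx) (mem_support_iff.mp hm)
    rw [Finsupp.degree_eq_weight_one]
    exact this
  by_contra! h
  have : m = 0 := by
    ext i
    exact h i (Set.mem_univ i)
  subst this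
  simp at hd
  omega

theorem lineHom_X_one : lineHom (X 1) = X 0 := aeval_X (R := ℂ) lineCoord 1

theorem lineHom_X_two : lineHom (X 2) = X 1 := aeval_X (R := ℂ) lineCoord 2

theorem irrelevant_le_map_lineHom : HomogeneousIdeal.irrelevant incidenceGrading ≤
    HomogeneousIdeal.map lineHom (HomogeneousIdeal.irrelevant dualGrading) := by
  refine toIdeal_le_toIdeal_iff.mp ?_
  refine irrelevant_incidence_le.trans (Ideal.span_le.mpr ?_)
  have h (i : Fin 3) : lineHom (X i) ∈
      (HomogeneousIdeal.map lineHom (HomogeneousIdeal.irrelevant dualGrading)).toIdeal := by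
    refine Ideal.mem_map_of_mem _ ?_
    exact HomogeneousIdeal.mem_irrelevant_of_mem _ one_pos (isHomogeneous_X ℂ i)
  rintro _ ⟨i, rfl⟩
  fin_cases i
  · exact lineHom_X_one ▸ h 1
  · exact lineHom_X_two ▸ h 2

/-- The projection from the incidence variety to the dual projective plane. -/
def incidenceToDual : Incidence ⟶ DualPlane := Proj.map lineHom irrelevant_le_map_lineHom

theorem range_incidenceToDual_subset :
    Set.range incidenceToDual ⊆ Set.range puncturedOpen.ι := by
  rintro _ ⟨x, rfl⟩
  rw [Scheme.Opens.range_ι]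
  have hx : x ∈ ⨆ i, Proj.basicOpen incidenceGrading (X i) := by
    rw [Proj.iSup_basicOpen_eq_top _ _ irrelevant_incidence_le]
    trivial
  obtain ⟨i, hi⟩ := TopologicalSpace.Opens.mem_iSup.mp hx
  change x ∈ incidenceToDual ⁻¹ᵁ (Proj.basicOpen dualGrading (X 1)) ∨
    x ∈ incidenceToDual ⁻¹ᵁ (Proj.basicOpen dualGrading (X 2))
  rw [incidenceToDual, Proj.map_preimage_basicOpen, Proj.map_preimage_basicOpen,
    lineHom_X_one, lineHom_X_two]
  fin_cases i
  · exact Or.inl hi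
  · exact Or.inr hi

/-- The projection `(t, ℓ) ↦ ℓ`. Its fibre over a line is that line. -/
def p₀ : Incidence ⟶ PuncturedDualPlane :=
  IsOpenImmersion.lift puncturedOpen.ι incidenceToDual range_incidenceToDual_subset

/-- The projection `(t, ℓ) ↦ t`. -/
def q₀ : Incidence ⟶ Plane :=
  Proj.toSpecZero incidenceGrading ≫
    Spec.map (CommRingCat.ofHom (algebraMap PlaneRing (incidenceGrading 0)))

section Equivariant

variable (M : Type) [AddCommGroup M] [Module PlaneRing M] [Module ℂ M]
  [IsScalarTower ℂ PlaneRing M]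

/-- An algebraic connection on the vector bundle over `𝔸²` given by a module `M`, as a map
`∇ : M → Ω¹ ⊗ M` on global sections. It need not be flat. -/
structure Connection where
  toLinearMap : M →ₗ[ℂ] Ω[PlaneRing⁄ℂ] ⊗[PlaneRing] M
  leibniz (f : PlaneRing) (m : M) :
    toLinearMap (f • m) = f • toLinearMap m + KaehlerDifferential.D ℂ PlaneRing f ⊗ₜ m

/-- Contraction of `Ω¹ ⊗ M` with the vector field `∂/∂tᵢ`. -/
def contract (i : Fin 2) : Ω[PlaneRing⁄ℂ] ⊗[PlaneRing] M →ₗ[PlaneRing] M :=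
  (TensorProduct.lid PlaneRing M).toLinearMap ∘ₗ
    LinearMap.rTensor M (pderiv (R := ℂ) i).liftKaehlerDifferential

variable {M} in
/-- The component `∇ᵢ` of `∇ = dt₁ ⊗ ∇₁ + dt₂ ⊗ ∇₂`. -/
def Connection.component (nabla : Connection M) (i : Fin 2) : M →ₗ[ℂ] M :=
  (contract M i).restrictScalars ℂ ∘ₗ nabla.toLinearMap

/-- The coordinate ring `ℂ[s₁^±1, s₂^±1]` of the torus `𝔾ₘ²`, with its Hopf algebra structure as
the group algebra of the character lattice `ℤ²`. -/
abbrev TorusRing : Type := AddMonoidAlgebra ℂ (Fin 2 → ℤ)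

/-- The coordinate function `sᵢ` of the torus. -/
def torusCoord (i : Fin 2) : TorusRing := AddMonoidAlgebra.single (Pi.single i 1) 1

/-- A `𝔾ₘ²`-equivariant structure on the quasi-coherent sheaf on `𝔸²` given by `M`, for the action
`(s, t) ↦ (s₁ t₁, s₂ t₂)`: a coaction of the coordinate ring of the torus on `M` which is semilinear
over the coaction `tᵢ ↦ sᵢ ⊗ tᵢ` on `ℂ[t₁, t₂]`. By `ℂ`-linearity it suffices to impose
semilinearity on the generators `tᵢ`. -/
structure EquivariantStructure where
  coact : M →ₗ[ℂ] TorusRing ⊗[ℂ] M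
  counit (m : M) : TensorProduct.lid ℂ M
      ((Coalgebra.counit (R := ℂ) (A := TorusRing)).rTensor M (coact m)) = m
  coassoc (m : M) : TensorProduct.assoc ℂ TorusRing TorusRing M
      ((Coalgebra.comul (R := ℂ) (A := TorusRing)).rTensor M (coact m)) =
        coact.lTensor TorusRing (coact m)
  coact_smul (i : Fin 2) (m : M) : coact ((X i : PlaneRing) • m) =
      TensorProduct.map (LinearMap.mulLeft ℂ (torusCoord i))
        (Algebra.lsmul ℂ ℂ M (X i : PlaneRing)) (coact m)

variable {M} in
/-- The connection is equivariant: `∇ : M → Ω¹ ⊗ M` commutes with the coactions. As `dtᵢ ↦ sᵢ ⊗ dtᵢ`,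
the coaction on `Ω¹ ⊗ M` sends `dtᵢ ⊗ n` to `sᵢ dtᵢ ⊗ ρ(n)`, so the condition reads
`sᵢ ρ(∇ᵢ m) = (1 ⊗ ∇ᵢ) ρ(m)` for `i = 1, 2`. -/
def Connection.IsEquivariant (nabla : Connection M) (ρ : EquivariantStructure M) : Prop :=
  ∀ (i : Fin 2) (m : M),
    (LinearMap.mulLeft ℂ (torusCoord i)).rTensor M (ρ.coact (nabla.component i m)) =
      (nabla.component i).lTensor TorusRing (ρ.coact m)

end Equivariant

section Transform

variable {Q : Scheme.{0}} (q : Q ⟶ Plane) (M : Type) [AddCommGroup M] [Module PlaneRing M]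

/-- The sheaf `E` on `𝔸²` whose module of global sections is `M`. -/
abbrev bundleSheaf : Plane.Modules := tilde (ModuleCat.of (CommRingCat.of PlaneRing) M)

/-- The sheaf `q^* E`. -/
abbrev bundlePullback : Q.Modules := (Scheme.Modules.pullback q).obj (bundleSheaf M)

theorem le_preimage_top {Y : Scheme.{0}} (g : Q ⟶ Y) (V : Q.Opens) : V ≤ g ⁻¹ᵁ ⊤ :=
  fun _ _ => trivial

/-- The function `q^* f` over `V`. -/
def pullbackFunction (V : Q.Opens) (f : PlaneRing) : Γ(Q, V) :=
  q.appLE ⊤ V (le_preimage_top q V) ((Scheme.ΓSpecIso (CommRingCat.of PlaneRing)).inv f)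

/-- An element of `M` as a global section of `E`. -/
def globalSection (m : M) : Γ(bundleSheaf M, ⊤) :=
  tilde.toOpen (ModuleCat.of (CommRingCat.of PlaneRing) M) ⊤ m

/-- The canonical morphism `E → q_* q^* E`. -/
def pullbackUnit : bundleSheaf M ⟶ (Scheme.Modules.pushforward q).obj (bundlePullback q M) :=
  (Scheme.Modules.pullbackPushforwardAdjunction q).unit.app (bundleSheaf M)

/-- The global section `q^* m` of `q^* E`. -/
def pullbackGlobalSection (m : M) : Γ(bundlePullback q M, q ⁻¹ᵁ ⊤) :=
  (pullbackUnit q M).app ⊤ (globalSection M m)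

variable {M}

/-- The section `q^* m` of `q^* E` over `V`. -/
def pullbackSection (V : Q.Opens) (m : M) : Γ(bundlePullback q M, V) :=
  (bundlePullback q M).presheaf.map (homOfLE (le_preimage_top q V)).op
    (pullbackGlobalSection q M m)

variable {P : Scheme.{0}} (p : Q ⟶ P)

/-- The relative differentials of `p`, formed from the functions on `V` and on `W`. -/
abbrev RelDifferentials (W : P.Opens) (V : Q.Opens) (h : V ≤ p ⁻¹ᵁ W) : ModuleCat Γ(Q, V) :=
  CommRingCat.KaehlerDifferential (p.appLE W V h)

variable (M) in
/-- Relative one-forms on `V` over `W` with values in `q^* E`. -/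
abbrev RelForms (W : P.Opens) (V : Q.Opens) (h : V ≤ p ⁻¹ᵁ W) : Type :=
  Γ(bundlePullback q M, V) ⊗[Γ(Q, V)] (RelDifferentials p W V h)

theorem map_pullbackSection {V V' : Q.Opens} (i : V' ⟶ V) (m : M) :
    (bundlePullback q M).presheaf.map i.op (pullbackSection q V m) = pullbackSection q V' m := by
  simp only [pullbackSection]
  rw [← CategoryTheory.comp_apply, ← Functor.map_comp]
  rfl

theorem map_pullbackFunction {V V' : Q.Opens} (i : V' ⟶ V) (f : PlaneRing) :
    Q.presheaf.map i.op (pullbackFunction q V f) = pullbackFunction q V' f := by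
  simp only [pullbackFunction]
  rw [← CategoryTheory.comp_apply, Scheme.Hom.appLE_map]

theorem appLE_comm {W W' : P.Opens} {V V' : Q.Opens} (h : V ≤ p ⁻¹ᵁ W) (h' : V' ≤ p ⁻¹ᵁ W')
    (i : V' ⟶ V) (j : W' ⟶ W) :
    P.presheaf.map j.op ≫ p.appLE W' V' h' = p.appLE W V h ≫ Q.presheaf.map i.op := by
  rw [Scheme.Hom.map_appLE, Scheme.Hom.appLE_map]

/-- Restriction of relative differentials to smaller open sets. -/
def restrictDifferentials {W W' : P.Opens} {V V' : Q.Opens} (h : V ≤ p ⁻¹ᵁ W)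
    (h' : V' ≤ p ⁻¹ᵁ W') (i : V' ⟶ V) (j : W' ⟶ W) :
    RelDifferentials p W V h →ₛₗ[(Q.presheaf.map i.op).hom] RelDifferentials p W' V' h' where
  toFun ω := CommRingCat.KaehlerDifferential.map (appLE_comm p h h' i j) ω
  map_add' := map_add (CommRingCat.KaehlerDifferential.map (appLE_comm p h h' i j)).hom
  map_smul' := map_smul (CommRingCat.KaehlerDifferential.map (appLE_comm p h h' i j)).hom

theorem restrictDifferentials_d {W W' : P.Opens} {V V' : Q.Opens} (h : V ≤ p ⁻¹ᵁ W)
    (h' : V' ≤ p ⁻¹ᵁ W') (i : V' ⟶ V) (j : W' ⟶ W) (f : Γ(Q, V)) :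
    restrictDifferentials p h h' i j (CommRingCat.KaehlerDifferential.d f) =
      CommRingCat.KaehlerDifferential.d (Q.presheaf.map i.op f) :=
  CommRingCat.KaehlerDifferential.map_d (appLE_comm p h h' i j) f

variable (M) in
/-- Restriction of `q^* E`-valued relative one-forms to smaller open sets. -/
def restrictForms {W W' : P.Opens} {V V' : Q.Opens} (h : V ≤ p ⁻¹ᵁ W) (h' : V' ≤ p ⁻¹ᵁ W')
    (i : V' ⟶ V) (j : W' ⟶ W) : RelForms q M p W V h →+ RelForms q M p W' V' h' :=
  TensorProduct.liftAddHom
    (AddMonoidHom.mk' (fun x => AddMonoidHom.mk' (fun ω =>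
        ((bundlePullback q M).presheaf.map i.op x) ⊗ₜ restrictDifferentials p h h' i j ω)
      (fun a b => by rw [map_add, TensorProduct.tmul_add]))
      (fun a b => by
        ext ω
        simp only [map_add, TensorProduct.add_tmul, AddMonoidHom.mk'_apply,
          AddMonoidHom.add_apply]))
    (by
      intro r x ω
      simp only [AddMonoidHom.mk'_apply]
      rw [Scheme.Modules.map_smul, LinearMap.map_smulₛₗ, TensorProduct.smul_tmul])

theorem restrictForms_tmul {W W' : P.Opens} {V V' : Q.Opens} (h : V ≤ p ⁻¹ᵁ W)
    (h' : V' ≤ p ⁻¹ᵁ W') (i : V' ⟶ V) (j : W' ⟶ W) (x : Γ(bundlePullback q M, V))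
    (ω : RelDifferentials p W V h) :
    restrictForms q M p h h' i j (x ⊗ₜ ω) =
      (bundlePullback q M).presheaf.map i.op x ⊗ₜ restrictDifferentials p h h' i j ω := rfl

section Horizontal

variable [Module ℂ M] [IsScalarTower ℂ PlaneRing M] (nabla : Connection M)

open CommRingCat.KaehlerDifferential in
/-- The value on `f · q^* m` of the relative connection induced by `∇` on `q^* E` along the fibres of
`p`: the Leibniz rule gives `q^* m ⊗ df + f · q^*(∇ m)`, where `∇ m = ∑ dtᵢ ⊗ ∇ᵢ m`. -/
def relDerivative (W : P.Opens) (V : Q.Opens) (h : V ≤ p ⁻¹ᵁ W) (f : Γ(Q, V)) (m : M) :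
    RelForms q M p W V h :=
  pullbackSection q V m ⊗ₜ (d f : RelDifferentials p W V h) +
    ∑ i, (f • pullbackSection q V (nabla.component i m)) ⊗ₜ
      (d (pullbackFunction q V (X i)) : RelDifferentials p W V h)

/-- The section `s` over `V` has the form `∑ fₖ · q^* mₖ`, and the relative connection sends it
to `0`. -/
def IsHorizontalOn (W : P.Opens) (V : Q.Opens) (h : V ≤ p ⁻¹ᵁ W)
    (s : Γ(bundlePullback q M, V)) : Prop :=
  ∃ (n : ℕ) (f : Fin n → Γ(Q, V)) (m : Fin n → M),
    s = ∑ k, f k • pullbackSection q V (m k) ∧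
      ∑ k, relDerivative q p nabla W V h (f k) (m k) = 0

/-- The section `s` of `q^* E` over `V` is covariantly constant along the fibres of `p`. Locally
every section of `q^* E` is a combination of sections `q^* m`, so that the relative connection can
be evaluated as in `IsHorizontalOn`; its vanishing is a local condition. -/
def IsHorizontal (V : Q.Opens) (s : Γ(bundlePullback q M, V)) : Prop :=
  ∀ y ∈ V, ∃ (W : P.Opens) (V' : Q.Opens) (h : V' ≤ p ⁻¹ᵁ W) (i : V' ⟶ V), y ∈ V' ∧
    IsHorizontalOn q p nabla W V' h ((bundlePullback q M).presheaf.map i.op s)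

variable {q p nabla}

theorem IsHorizontalOn.restrict {W W' : P.Opens} {V V' : Q.Opens} {h : V ≤ p ⁻¹ᵁ W}
    (h' : V' ≤ p ⁻¹ᵁ W') (i : V' ⟶ V) (j : W' ⟶ W) {s : Γ(bundlePullback q M, V)}
    (hs : IsHorizontalOn q p nabla W V h s) :
    IsHorizontalOn q p nabla W' V' h' ((bundlePullback q M).presheaf.map i.op s) := by
  obtain ⟨n, f, m, rfl, h0⟩ := hs
  refine ⟨n, fun k => Q.presheaf.map i.op (f k), m, ?_, ?_⟩
  · simp only [map_sum, Scheme.Modules.map_smul, map_pullbackSection]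
  · have := congrArg (restrictForms q M p h h' i j) h0
    simpa only [map_sum, map_zero, relDerivative, map_add, restrictForms_tmul,
      restrictDifferentials_d, Scheme.Modules.map_smul, map_pullbackSection,
      map_pullbackFunction] using this

theorem IsHorizontalOn.zero {W : P.Opens} {V : Q.Opens} {h : V ≤ p ⁻¹ᵁ W} :
    IsHorizontalOn q p nabla W V h 0 :=
  ⟨0, Fin.elim0, Fin.elim0, by simp, by simp⟩

theorem IsHorizontalOn.add {W : P.Opens} {V : Q.Opens} {h : V ≤ p ⁻¹ᵁ W}
    {s t : Γ(bundlePullback q M, V)} (hs : IsHorizontalOn q p nabla W V h s)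
    (ht : IsHorizontalOn q p nabla W V h t) : IsHorizontalOn q p nabla W V h (s + t) := by
  obtain ⟨n, f, m, rfl, h0⟩ := hs
  obtain ⟨n', f', m', rfl, h0'⟩ := ht
  refine ⟨n + n', Fin.append f f', Fin.append m m', ?_, ?_⟩
  · simp [Fin.sum_univ_add]
  · simp [Fin.sum_univ_add, h0, h0']

theorem IsHorizontalOn.smul {W : P.Opens} {V : Q.Opens} {h : V ≤ p ⁻¹ᵁ W}
    {s : Γ(bundlePullback q M, V)} (hs : IsHorizontalOn q p nabla W V h s) (a : Γ(P, W)) :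
    IsHorizontalOn q p nabla W V h (p.appLE W V h a • s) := by
  obtain ⟨n, f, m, rfl, h0⟩ := hs
  refine ⟨n, fun k => p.appLE W V h a * f k, m, ?_, ?_⟩
  · simp [Finset.smul_sum, mul_smul]
  · have := congrArg (p.appLE W V h a • ·) h0
    simp only [Finset.smul_sum, smul_zero] at this
    rw [← this]
    refine Finset.sum_congr rfl fun k _ => ?_
    simp only [relDerivative, smul_add, Finset.smul_sum, ModuleCat.Derivation.d_mul,
      ModuleCat.Derivation.d_map, smul_zero, add_zero, TensorProduct.tmul_smul, mul_smul,
      TensorProduct.smul_tmul']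

theorem IsHorizontal.map {V V' : Q.Opens} (i : V' ⟶ V) {s : Γ(bundlePullback q M, V)}
    (hs : IsHorizontal q p nabla V s) :
    IsHorizontal q p nabla V' ((bundlePullback q M).presheaf.map i.op s) := by
  intro y hy
  obtain ⟨W, V₁, h, j, hy₁, H⟩ := hs y (i.le hy)
  refine ⟨W, V₁ ⊓ V', inf_le_left.trans h, homOfLE inf_le_right, ⟨hy₁, hy⟩, ?_⟩
  have := H.restrict (inf_le_left.trans h) (homOfLE (inf_le_left : V₁ ⊓ V' ≤ V₁)) (𝟙 W)
  rw [← CategoryTheory.comp_apply, ← Functor.map_comp, ← op_comp] at this ⊢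
  exact this

theorem IsHorizontal.of_local {V : Q.Opens} {s : Γ(bundlePullback q M, V)}
    (hs : ∀ y ∈ V, ∃ (V' : Q.Opens) (i : V' ⟶ V), y ∈ V' ∧
      IsHorizontal q p nabla V' ((bundlePullback q M).presheaf.map i.op s)) :
    IsHorizontal q p nabla V s := by
  intro y hy
  obtain ⟨V', i, hy', H⟩ := hs y hy
  obtain ⟨W, V₁, h, j, hy₁, H₁⟩ := H y hy'
  refine ⟨W, V₁, h, j ≫ i, hy₁, ?_⟩
  rw [← CategoryTheory.comp_apply, ← Functor.map_comp, ← op_comp] at H₁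
  exact H₁

theorem IsHorizontal.zero {V : Q.Opens} :
    IsHorizontal q p nabla V (0 : Γ(bundlePullback q M, V)) :=
  fun y hy => ⟨⊤, V, le_preimage_top p V, 𝟙 _, hy, by
    rw [map_zero]; exact IsHorizontalOn.zero⟩

theorem IsHorizontal.add {V : Q.Opens} {s t : Γ(bundlePullback q M, V)}
    (hs : IsHorizontal q p nabla V s) (ht : IsHorizontal q p nabla V t) :
    IsHorizontal q p nabla V (s + t) := by
  intro y hy
  obtain ⟨W, V₁, h, j, hy₁, H⟩ := hs y hy
  obtain ⟨W', V₁', h', j', hy₁', H'⟩ := ht y hy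
  have hle : V₁ ⊓ V₁' ≤ p ⁻¹ᵁ (W ⊓ W') := inf_le_inf h h'
  refine ⟨W ⊓ W', V₁ ⊓ V₁', hle, homOfLE (inf_le_left.trans j.le), ⟨hy₁, hy₁'⟩, ?_⟩
  have := (H.restrict hle (homOfLE inf_le_left) (homOfLE inf_le_left)).add
    (H'.restrict hle (homOfLE inf_le_right) (homOfLE inf_le_right))
  rw [← CategoryTheory.comp_apply, ← CategoryTheory.comp_apply, ← Functor.map_comp,
    ← Functor.map_comp, ← op_comp, ← op_comp] at this
  rw [map_add]
  exact this

theorem IsHorizontal.smul {U : P.Opens} {s : Γ(bundlePullback q M, p ⁻¹ᵁ U)}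
    (hs : IsHorizontal q p nabla (p ⁻¹ᵁ U) s) (a : Γ(P, U)) :
    IsHorizontal q p nabla (p ⁻¹ᵁ U) (p.app U a • s) := by
  intro y hy
  obtain ⟨W, V₁, h, j, hy₁, H⟩ := hs y hy
  have hle : V₁ ≤ p ⁻¹ᵁ (W ⊓ U) := le_inf h j.le
  refine ⟨W ⊓ U, V₁, hle, j, hy₁, ?_⟩
  have := (H.restrict hle (𝟙 V₁) (homOfLE inf_le_left)).smul
    (P.presheaf.map (homOfLE (inf_le_right : W ⊓ U ≤ U)).op a)
  rw [← CategoryTheory.comp_apply, ← CategoryTheory.comp_apply, ← Functor.map_comp,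
    Scheme.Hom.map_appLE, ← op_comp, Category.id_comp] at this
  rw [Scheme.Modules.map_smul, ← CategoryTheory.comp_apply]
  exact this

variable (q p nabla)

/-- The covariantly constant sections along the fibres of `p` as a submodule of `p_* q^* E`. -/
def horizontalSubmodule :
    ((Scheme.Modules.pushforward p).obj (bundlePullback q M)).val.Submodule where
  obj U :=
    { carrier := {s | IsHorizontal q p nabla (p ⁻¹ᵁ U.unop) s}
      add_mem' := IsHorizontal.add
      zero_mem' := IsHorizontal.zero
      smul_mem' := fun a _ hs => hs.smul a }
  map f := fun _ hs => IsHorizontal.map ((TopologicalSpace.Opens.map p.base).map f.unop) hs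

theorem horizontalSubmodule_isSheaf : Presheaf.IsSheaf (Opens.grothendieckTopology P)
    (horizontalSubmodule q p nabla).toPresheafOfModules.presheaf := by
  let F := (Scheme.Modules.pushforward p).obj (bundlePullback q M)
  have hF : Presieve.IsSheaf (Opens.grothendieckTopology P)
      (F.val.presheaf ⋙ forget AddCommGrpCat) :=
    (isSheaf_iff_isSheaf_of_type _ _).mp
      ((Presheaf.isSheaf_iff_isSheaf_forget _ _ (forget AddCommGrpCat)).mp F.isSheaf)
  let G : Subfunctor (F.val.presheaf ⋙ forget AddCommGrpCat) :=
    { obj := fun U => {s | IsHorizontal q p nabla (p ⁻¹ᵁ U.unop) s}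
      map := fun f s hs =>
        IsHorizontal.map ((TopologicalSpace.Opens.map p.base).map f.unop) hs }
  have hG : Presieve.IsSheaf (Opens.grothendieckTopology P) G.toFunctor := by
    rw [Subfunctor.isSheaf_iff _ hF]
    intro U s hs
    refine IsHorizontal.of_local fun y hy => ?_
    obtain ⟨U', i, hi, hyi⟩ := hs (p y) hy
    exact ⟨p ⁻¹ᵁ U', (TopologicalSpace.Opens.map p.base).map i, hyi, hi⟩
  rw [Presheaf.isSheaf_iff_isSheaf_forget _ _ (forget AddCommGrpCat)]
  exact (isSheaf_iff_isSheaf_of_type _ _).mpr hG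

/-- The sheaf `p_*^∇ (q^* E)` of sections of `q^* E` that are covariantly constant along the fibres
of `p`, a subsheaf of `𝒪_P`-modules of `p_* q^* E`. -/
def horizontalSheaf : P.Modules where
  val := (horizontalSubmodule q p nabla).toPresheafOfModules
  isSheaf := horizontalSubmodule_isSheaf q p nabla

end Horizontal

end Transform

/-- A sheaf of modules that is locally isomorphic to `𝒪^r`. -/
def IsLocallyFreeOfRank {X : Scheme.{0}} (F : X.Modules) (r : ℕ) : Prop :=
  ∀ x : X, ∃ U : X.Opens, x ∈ U ∧
    Nonempty (F.restrict U.ι ≅ (SheafOfModules.free (Fin r) : U.toScheme.Modules))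

/-- The Radon-Penrose transform of a bundle with connection on `𝔸²`: the sheaf on the punctured dual
plane of the sections of `q₀^* E` that are covariantly constant along the fibres of `p₀`. -/
def radonPenroseTransform {M : Type} [AddCommGroup M] [Module PlaneRing M] [Module ℂ M]
    [IsScalarTower ℂ PlaneRing M] (nabla : Connection M) : PuncturedDualPlane.Modules :=
  horizontalSheaf q₀ p₀ nabla

end

end RadonPenrose

/-! Two facts carry the proof: torus weights make the connection nilpotent, and restricted to lines
it becomes an ordinary differential equation solvable in polynomials.

The coaction splits `M` into weight spaces. Localizing at the origin and extracting a basis of the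
fibre from weight vectors gives a basis of `M` itself by weight vectors (`exists_basis_isWeight`).
Since `∇ᵢ` lowers the weight by `eᵢ` and polynomials have only nonnegative weights, a nonzero entry
`(j, k)` of a connection matrix forces the total weight of `b j` to be strictly smaller than that of
`b k` (`weight_lt`): both matrices are strictly triangular for one common order.

Over the lines with `v_{a+1} ≠ 0` the incidence variety is a product of the base with an affine line
(`bijective_flagEval`); the coordinate `τ` is the other affine coordinate, and each `tᵢ` is affine
linear in `τ`. The relative connection is `d/dτ + N` with `N` strictly triangular. Picard iteration
for `G' + N G = 0` stops after finitely many steps, each step needing only primitives of polynomials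
in characteristic zero, so `G` is polynomial in `τ` and unipotent, hence invertible
(`exists_isUnit_solution`). Curvature plays no role, because the fibres are one-dimensional.

In the frame given by the columns of `G` the connection is the plain relative differential
(`coordDerivative_gauge`), so horizontal sections are those whose coefficients have zero relative
differential. Such coefficients come from the base (`exists_app_eq_of_relD`), so the columns of `G`
are a basis of the horizontal sheaf over each of the two charts, and these cover the punctured dual
plane. -/

namespace RadonPenrose

noncomputable section

open CategoryTheory AlgebraicGeometry MvPolynomial TensorProduct Opposite

/-! ### Weight decomposition and weight bases -/

section Weights

/-- The coefficient of the character `χ` in an element of `ℂ[ℤ²] ⊗ M`. -/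
def coeffTensor (M : Type) [AddCommGroup M] [Module ℂ M] (χ : Fin 2 → ℤ) :
    TorusRing ⊗[ℂ] M →ₗ[ℂ] M :=
  (TensorProduct.lid ℂ M).toLinearMap ∘ₗ
    LinearMap.rTensor M (Finsupp.lapply χ ∘ₗ (AddMonoidAlgebra.coeffLinearEquiv ℂ).toLinearMap)

theorem coeffTensor_tmul {M : Type} [AddCommGroup M] [Module ℂ M] (χ : Fin 2 → ℤ)
    (a : TorusRing) (m : M) :
    coeffTensor M χ (a ⊗ₜ m) = a.coeff χ • m := by
  simp [coeffTensor]

variable {M : Type} [AddCommGroup M] [Module PlaneRing M] [Module ℂ M]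
  [IsScalarTower ℂ PlaneRing M] (ρ : EquivariantStructure M)

/-- The element `m` has weight `χ` under the coaction of the torus. -/
def EquivariantStructure.IsWeight (χ : Fin 2 → ℤ) (m : M) : Prop :=
  ρ.coact m = (AddMonoidAlgebra.single χ 1 : TorusRing) ⊗ₜ m

/-- The projection to the component of weight `χ`. -/
def EquivariantStructure.proj (χ : Fin 2 → ℤ) : M →ₗ[ℂ] M :=
  coeffTensor M χ ∘ₗ ρ.coact

variable {ρ}

theorem EquivariantStructure.IsWeight.proj {χ : Fin 2 → ℤ} {m : M} (h : ρ.IsWeight χ m)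
    (ψ : Fin 2 → ℤ) : ρ.proj ψ m = if χ = ψ then m else 0 := by
  rw [EquivariantStructure.proj, LinearMap.comp_apply, h, coeffTensor_tmul,
    AddMonoidAlgebra.coeff_single, Finsupp.single_apply]
  split_ifs <;> simp

theorem EquivariantStructure.IsWeight.smul_X {χ : Fin 2 → ℤ} {m : M} (h : ρ.IsWeight χ m)
    (i : Fin 2) : ρ.IsWeight (χ + Pi.single i 1) ((X i : PlaneRing) • m) := by
  rw [EquivariantStructure.IsWeight, ρ.coact_smul, h, TensorProduct.map_tmul]
  simp [torusCoord, AddMonoidAlgebra.single_mul_single, add_comm]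

theorem EquivariantStructure.IsWeight.smul {χ : Fin 2 → ℤ} {m : M} (h : ρ.IsWeight χ m)
    (c : ℂ) : ρ.IsWeight χ (c • m) := by
  rw [EquivariantStructure.IsWeight, map_smul, h, TensorProduct.tmul_smul]

theorem EquivariantStructure.IsWeight.smul_monomial {χ : Fin 2 → ℤ} {m : M}
    (h : ρ.IsWeight χ m) (a : Fin 2 →₀ ℕ) (c : ℂ) :
    ρ.IsWeight (χ + fun i => (a i : ℤ)) ((monomial a c : PlaneRing) • m) := by
  have hp (i : Fin 2) (n : ℕ) {χ : Fin 2 → ℤ} {m : M} (h : ρ.IsWeight χ m) :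
      ρ.IsWeight (χ + Pi.single i (n : ℤ)) ((X i ^ n : PlaneRing) • m) := by
    induction n with
    | zero => simpa using h
    | succ n ih =>
      have := ih.smul_X i
      rw [add_assoc, ← Pi.single_add, smul_smul, ← pow_succ'] at this
      exact_mod_cast this
  have h2 := ((hp 1 (a 1) h).smul c |> hp 0 (a 0))
  have e1 : χ + Pi.single 1 (a 1 : ℤ) + Pi.single 0 (a 0 : ℤ) = χ + fun i => (a i : ℤ) := by
    ext i; fin_cases i <;> simp
  have e2 : (X 0 ^ a 0 : PlaneRing) • c • (X 1 ^ a 1 : PlaneRing) • m =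
      (monomial a c : PlaneRing) • m := by
    rw [smul_comm, ← smul_assoc, smul_smul]
    congr 1
    rw [monomial_eq, Finsupp.prod_fintype _ _ (fun i => pow_zero _), Fin.prod_univ_two,
      Algebra.smul_def, algebraMap_eq, mul_assoc]
  rwa [e1, e2] at h2

variable (ρ) in
-- Characters are grouplike, `χ ↦ χ ⊗ χ`. Reading off the coefficient of `χ` in the first tensor
-- factor on both sides of coassociativity therefore gives `χ ⊗ m_χ` on one side and `ρ(m_χ)` on the
-- other.
theorem EquivariantStructure.isWeight_proj (χ : Fin 2 → ℤ) (m : M) :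
    ρ.IsWeight χ (ρ.proj χ m) := by
  have key : (coeffTensor (TorusRing ⊗[ℂ] M) χ) ∘ₗ
      (TensorProduct.assoc ℂ TorusRing TorusRing M).toLinearMap ∘ₗ
        (Coalgebra.comul (R := ℂ) (A := TorusRing)).rTensor M =
      TensorProduct.mk ℂ TorusRing M (AddMonoidAlgebra.single χ 1) ∘ₗ coeffTensor M χ := by
    ext ψ n
    simp only [LinearMap.comp_apply, AddMonoidAlgebra.lsingle_apply,
      AlgebraTensorModule.curry_apply, LinearMap.restrictScalars_self, curry_apply,
      LinearMap.rTensor_tmul, AddMonoidAlgebra.comul_single, CommSemiring.comul_apply,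
      TensorProduct.map_tmul, LinearEquiv.coe_coe, TensorProduct.assoc_tmul, coeffTensor_tmul,
      AddMonoidAlgebra.coeff_single, Finsupp.single_apply, TensorProduct.mk_apply]
    split_ifs with h
    · subst h; simp
    · simp
  have key' : (coeffTensor (TorusRing ⊗[ℂ] M) χ) ∘ₗ ρ.coact.lTensor TorusRing =
      ρ.coact ∘ₗ coeffTensor M χ := by
    ext ψ n
    simp [coeffTensor_tmul]
  have h1 := LinearMap.congr_fun key (ρ.coact m)
  have h2 := LinearMap.congr_fun key' (ρ.coact m)
  simp only [LinearMap.comp_apply, LinearEquiv.coe_coe] at h1 h2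
  rw [ρ.coassoc, h2] at h1
  exact h1

variable (ρ) in
-- The counit sends every character to `1`, so the counit axiom writes `m` as the finite sum of its
-- weight components.
theorem EquivariantStructure.mem_span_proj (m : M) :
    m ∈ Submodule.span ℂ {n : M | ∃ χ, ρ.IsWeight χ n} := by
  have key : ∀ x : TorusRing ⊗[ℂ] M, TensorProduct.lid ℂ M
      ((Coalgebra.counit (R := ℂ) (A := TorusRing)).rTensor M x) ∈
        Submodule.span ℂ (Set.range fun χ => coeffTensor M χ x) := by
    intro x
    -- Allowing every larger index set `T` lets the induction pass to the union of two supports.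
    have : ∃ S : Finset (Fin 2 → ℤ), ∀ T, S ⊆ T → TensorProduct.lid ℂ M
        ((Coalgebra.counit (R := ℂ) (A := TorusRing)).rTensor M x) =
          ∑ χ ∈ T, coeffTensor M χ x := by
      classical
      induction x using TensorProduct.induction_on with
      | zero => exact ⟨∅, by simp⟩
      | add x y hx hy =>
        obtain ⟨S, hS⟩ := hx
        obtain ⟨S', hS'⟩ := hy
        refine ⟨S ∪ S', fun T hT => ?_⟩
        rw [map_add, map_add, hS T (Finset.union_subset_left hT),
          hS' T (Finset.union_subset_right hT), ← Finset.sum_add_distrib]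
        simp
      | tmul a m =>
        refine ⟨a.coeff.support, fun T hT => ?_⟩
        simp only [coeffTensor_tmul, LinearMap.rTensor_tmul, TensorProduct.lid_tmul]
        rw [← Finset.sum_smul]
        congr 1
        rw [← Finset.sum_subset hT (fun χ _ h => by simpa using h)]
        conv_lhs => rw [← AddMonoidAlgebra.sum_coeff_single a]
        simp [Finsupp.sum]
    obtain ⟨S, hS⟩ := this
    rw [hS S subset_rfl]
    exact Submodule.sum_mem _ fun χ _ => Submodule.subset_span ⟨χ, rfl⟩
  have := key (ρ.coact m)
  rw [ρ.counit] at this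
  refine Submodule.span_mono ?_ this
  rintro _ ⟨χ, rfl⟩
  exact ⟨χ, ρ.isWeight_proj χ m⟩

/-- The part of degree `δ` of a polynomial. -/
def degreePart (δ : Fin 2 → ℤ) (s : PlaneRing) : PlaneRing :=
  if ∀ i, 0 ≤ δ i then
    monomial (Finsupp.equivFunOnFinite.symm fun i => (δ i).toNat)
      (coeff (Finsupp.equivFunOnFinite.symm fun i => (δ i).toNat) s)
  else 0

/-- A monomial shifts weights by its exponent, so only the monomial of exponent `ψ - χ` can
contribute; if that vector has a negative entry there is none. -/
theorem EquivariantStructure.IsWeight.proj_smul {χ : Fin 2 → ℤ} {m : M} (h : ρ.IsWeight χ m)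
    (ψ : Fin 2 → ℤ) (s : PlaneRing) : ρ.proj ψ (s • m) = degreePart (ψ - χ) s • m := by
  induction s using MvPolynomial.induction_on' with
  | add p q hp hq =>
    rw [add_smul, map_add, hp, hq, ← add_smul]
    congr 1
    simp only [degreePart]
    split_ifs <;> simp
  | monomial a c =>
    rw [(h.smul_monomial a c).proj]
    simp only [degreePart, coeff_monomial]
    by_cases hc : (χ + fun i => (a i : ℤ)) = ψ
    · subst hc
      simp
    · rw [if_neg hc]
      split_ifs with h1 h2
      · refine (hc ?_).elim
        ext i
        have := h1 i
        have h3 := DFunLike.congr_fun h2 i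
        simp only [Pi.sub_apply, Finsupp.equivFunOnFinite_symm_apply_apply] at this h3
        simp only [Pi.add_apply]
        omega
      · simp
      · simp

variable (ρ) in
/-- An equivariant vector bundle on the affine plane has a basis of weight vectors. -/
theorem EquivariantStructure.exists_basis_isWeight
    [Module.Finite PlaneRing M] [Module.Projective PlaneRing M]
    (r : ℕ) (hr : ∀ x : PrimeSpectrum PlaneRing, Module.rankAtStalk M x = r) :
    ∃ (b : Module.Basis (Fin r) PlaneRing M) (χ : Fin r → Fin 2 → ℤ),
      ∀ j, ρ.IsWeight (χ j) (b j) := by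
  -- The ideal of the origin, the torus-fixed point. Weight vectors generate the localization there,
  -- so a basis over this local ring can be chosen among them.
  let I : Ideal PlaneRing := RingHom.ker (constantCoeff (σ := Fin 2) (R := ℂ))
  have hI : I.IsPrime := RingHom.ker_isPrime _
  let v : {n : M // ∃ χ, ρ.IsWeight χ n} → LocalizedModule I.primeCompl M :=
    fun n => LocalizedModule.mkLinearMap I.primeCompl M n
  have hspan : Submodule.span PlaneRing {n : M | ∃ χ, ρ.IsWeight χ n} = ⊤ := by
    rw [eq_top_iff]
    intro m _
    exact Submodule.span_le_restrictScalars ℂ PlaneRing _ (ρ.mem_span_proj m)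
  have hv : Submodule.span (Localization.AtPrime I) (Set.range v) = ⊤ := by
    rw [← span_eq_top_of_isLocalizedModule (Localization.AtPrime I) I.primeCompl
      (LocalizedModule.mkLinearMap I.primeCompl M) hspan]
    congr 1
    ext x
    simp [v]
  have : Module.FinitePresentation (Localization.AtPrime I) (LocalizedModule I.primeCompl M) :=
    Module.finitePresentation_of_projective _ _
  obtain ⟨κ, a, b, hb⟩ := Module.exists_basis_of_span_of_flat v hv
  have hcard : Module.finrank (Localization.AtPrime I) (LocalizedModule I.primeCompl M) = r :=
    hr ⟨I, hI⟩
  have : Finite κ := Module.Finite.finite_basis b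
  have := Fintype.ofFinite κ
  have e : κ ≃ Fin r := Fintype.equivFinOfCardEq (by rw [← hcard, Module.finrank_eq_card_basis b])
  let w : Fin r → M := fun j => (a (e.symm j)).1
  choose χ hχ using fun j => (a (e.symm j)).2
  have hw : ∀ j, LocalizedModule.mkLinearMap I.primeCompl M (w j) = b.reindex e j := by
    intro j
    simp [hb, v, w]
  have hli : LinearIndependent PlaneRing w := by
    refine LinearIndependent.of_comp (LocalizedModule.mkLinearMap I.primeCompl M) ?_
    rw [show LocalizedModule.mkLinearMap I.primeCompl M ∘ w = b.reindex e from funext hw]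
    refine (b.reindex e).linearIndependent.restrict_scalars ?_
    intro x y hxy
    refine IsLocalization.injective (Localization.AtPrime I) I.primeCompl_le_nonZeroDivisors ?_
    simpa [Algebra.smul_def] using hxy
  -- A weight vector `m` of weight `ψ` enters the span `N` of `w` after multiplication by some
  -- polynomial not vanishing at the origin. As `N` is stable under weight projections, it contains
  -- the component of weight `ψ` of that product, which is a nonzero constant times `m`.
  have hsp : ⊤ ≤ Submodule.span PlaneRing (Set.range w) := by
    rw [← hspan, Submodule.span_le]
    rintro m ⟨ψ, hψ⟩
    have hm : LocalizedModule.mkLinearMap I.primeCompl M m ∈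
        Submodule.span (Localization.AtPrime I) (Set.range (b.reindex e)) := by
      rw [(b.reindex e).span_eq]
      trivial
    obtain ⟨t, ht⟩ := multiple_mem_span_of_mem_localization_span I.primeCompl (Localization.AtPrime I) _ _ hm
    rw [← show LocalizedModule.mkLinearMap I.primeCompl M ∘ w = b.reindex e from funext hw,
      Set.range_comp, ← Submodule.map_span, Submodule.mem_map] at ht
    obtain ⟨n, hn, hnt⟩ := ht
    rw [Submonoid.smul_def, ← map_smul,
      IsLocalizedModule.eq_iff_exists I.primeCompl] at hnt
    obtain ⟨u, hu⟩ := hnt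
    have hmem : ((u * t : I.primeCompl) : PlaneRing) • m ∈
        Submodule.span PlaneRing (Set.range w) := by
      have : ((u * t : I.primeCompl) : PlaneRing) • m = u • (t : PlaneRing) • m := by
        rw [Submonoid.smul_def, smul_smul]; rfl
      rw [this, ← hu]
      exact Submodule.smul_mem _ _ hn
    have hproj : ∀ x ∈ Submodule.span PlaneRing (Set.range w),
        ρ.proj ψ x ∈ Submodule.span PlaneRing (Set.range w) := by
      intro x hx
      obtain ⟨c, rfl⟩ := (Submodule.mem_span_range_iff_exists_fun _).mp hx
      rw [map_sum]
      refine Submodule.sum_mem _ fun j _ => ?_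
      rw [(hχ j).proj_smul]
      exact Submodule.smul_mem _ _ (Submodule.subset_span ⟨j, rfl⟩)
    have h0 := hproj _ hmem
    rw [hψ.proj_smul, degreePart, if_pos (by simp)] at h0
    -- Lying outside the ideal of the origin means having a nonzero constant coefficient.
    have hc : constantCoeff ((u * t : I.primeCompl) : PlaneRing) ≠ 0 := (u * t).2
    have hz : (Finsupp.equivFunOnFinite.symm fun i => ((ψ - ψ) i).toNat : Fin 2 →₀ ℕ) = 0 := by
      ext i; simp
    rw [hz, ← constantCoeff_eq] at h0
    have := Submodule.smul_mem _ (C (constantCoeff ((u * t : I.primeCompl) : PlaneRing))⁻¹) h0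
    rwa [smul_smul, ← C_apply, ← C_mul, inv_mul_cancel₀ hc, C_1, one_smul] at this
  refine ⟨Module.Basis.mk hli hsp, χ, fun j => ?_⟩
  rw [Module.Basis.mk_apply]
  exact hχ j

/-- The form `dtᵢ` has weight `eᵢ` and `∇` preserves weights, so `∇ᵢ` lowers them by `eᵢ`;
concretely, the equivariance identity is multiplied by `sᵢ⁻¹`. -/
theorem Connection.IsEquivariant.isWeight_component {nabla : Connection M}
    (h : nabla.IsEquivariant ρ) {χ : Fin 2 → ℤ} {m : M} (hm : ρ.IsWeight χ m) (i : Fin 2) :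
    ρ.IsWeight (χ - Pi.single i 1) (nabla.component i m) := by
  have := h i m
  rw [hm, LinearMap.lTensor_tmul] at this
  have h2 := congrArg ((LinearMap.mulLeft ℂ
    (AddMonoidAlgebra.single (-Pi.single i 1) 1 : TorusRing)).rTensor M) this
  rw [← LinearMap.comp_apply, ← LinearMap.rTensor_comp, ← LinearMap.mulLeft_mul, torusCoord,
    AddMonoidAlgebra.single_mul_single, neg_add_cancel, mul_one,
    ← AddMonoidAlgebra.one_def, LinearMap.mulLeft_one, LinearMap.rTensor_id, LinearMap.rTensor_tmul,
    LinearMap.mulLeft_apply, AddMonoidAlgebra.single_mul_single, mul_one] at h2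
  rw [EquivariantStructure.IsWeight, sub_eq_neg_add]
  exact h2

/-- In a basis of weight vectors the connection matrices are strictly triangular for the order by
total weight. -/
theorem Connection.IsEquivariant.weight_lt {nabla : Connection M}
    (h : nabla.IsEquivariant ρ) {r : ℕ} (b : Module.Basis (Fin r) PlaneRing M)
    (χ : Fin r → Fin 2 → ℤ) (hb : ∀ j, ρ.IsWeight (χ j) (b j)) (i : Fin 2) (j k : Fin r)
    (hjk : b.repr (nabla.component i (b k)) j ≠ 0) : ∑ l, χ j l < ∑ l, χ k l := by
  have hw := h.isWeight_component (hb k) i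
  have h1 := hw.proj (χ k - Pi.single i 1)
  rw [if_pos rfl] at h1
  conv_lhs at h1 => rw [← b.sum_repr (nabla.component i (b k)), map_sum]
  -- Each coordinate equals its own part of degree `χ k - eᵢ - χ j`. A nonzero one requires this
  -- vector to be nonnegative, so the total weight drops by at least one from `k` to `j`.
  have h2 := congrArg (fun x => b.repr x j) h1
  simp only [(hb _).proj_smul] at h2
  rw [b.repr_sum_self] at h2
  rw [← h2, degreePart] at hjk
  split_ifs at hjk with h3
  · have h0 := h3 0
    have h1 := h3 1
    simp only [Pi.sub_apply] at h0 h1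
    rw [Fin.sum_univ_two, Fin.sum_univ_two]
    fin_cases i <;> simp at h0 h1 <;> omega
  · exact (hjk rfl).elim

end Weights

/-! ### Morphisms of sheaves of modules given on sections -/

section ModuleMorphisms

/-- The structure sheaf as a sheaf of modules over itself. -/
abbrev unitModule (Y : Scheme.{0}) : Y.Modules := SheafOfModules.unit Y.ringCatSheaf

/-- A morphism of sheaves of modules from compatible linear maps on sections. -/
def modulesHomMk {Y : Scheme.{0}} {F G : Y.Modules} (φ : ∀ U : Y.Opens, Γ(F, U) →ₗ[Γ(Y, U)] Γ(G, U))
    (hφ : ∀ {U V : Y.Opens} (i : V ⟶ U) (x : Γ(F, U)),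
      φ V (F.presheaf.map i.op x) = G.presheaf.map i.op (φ U x)) : F ⟶ G :=
  SheafOfModules.Hom.mk (X := F) (Y := G)
    { app := fun U => ModuleCat.ofHom (X := F.val.obj U) (Y := G.val.obj U) (φ U.unop)
      naturality := fun {U V} f => by
        ext x
        exact hφ f.unop x }

theorem modulesHomMk_app {Y : Scheme.{0}} {F G : Y.Modules}
    (φ : ∀ U : Y.Opens, Γ(F, U) →ₗ[Γ(Y, U)] Γ(G, U))
    (hφ : ∀ {U V : Y.Opens} (i : V ⟶ U) (x : Γ(F, U)),
      φ V (F.presheaf.map i.op x) = G.presheaf.map i.op (φ U x)) (U : Y.Opens) (x : Γ(F, U)) :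
    (modulesHomMk φ hφ).app U x = φ U x := rfl

/-- The map on sections of a morphism of sheaves of modules, as a linear map. -/
def appLinear {Y : Scheme.{0}} {F G : Y.Modules} (φ : F ⟶ G) (U : Y.Opens) :
    Γ(F, U) →ₗ[Γ(Y, U)] Γ(G, U) where
  toFun x := φ.app U x
  map_add' := map_add _
  map_smul' := φ.app_smul

theorem app_map {Y : Scheme.{0}} {F G : Y.Modules} (φ : F ⟶ G) {U V : Y.Opens} (i : V ⟶ U)
    (x : Γ(F, U)) : φ.app V (F.presheaf.map i.op x) = G.presheaf.map i.op (φ.app U x) :=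
  NatTrans.naturality_apply φ.mapPresheaf i.op x

/-- The morphism `f ↦ f • s` from the structure sheaf given by a section `s`. -/
def unitHomOfSection {Y : Scheme.{0}} {F : Y.Modules} {U₀ : Y.Opens} (h : ∀ U : Y.Opens, U ≤ U₀)
    (s : Γ(F, U₀)) : unitModule Y ⟶ F :=
  modulesHomMk (F := unitModule Y)
    (fun U => LinearMap.toSpanSingleton Γ(Y, U) Γ(F, U) (F.presheaf.map (homOfLE (h U)).op s))
    (fun {U V} i x => by
      have key (f : Γ(Y, U)) : Y.presheaf.map i.op f • F.presheaf.map (homOfLE (h V)).op s =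
          F.presheaf.map i.op (f • F.presheaf.map (homOfLE (h U)).op s) := by
        rw [Scheme.Modules.map_smul, ← CategoryTheory.comp_apply (F.presheaf.map _),
          ← Functor.map_comp]
        rfl
      exact key x)

theorem unitHomOfSection_app {Y : Scheme.{0}} {F : Y.Modules} {U₀ : Y.Opens}
    (h : ∀ U : Y.Opens, U ≤ U₀) (s : Γ(F, U₀)) (U : Y.Opens) (f : Γ(Y, U)) :
    (unitHomOfSection h s).app U f = f • F.presheaf.map (homOfLE (h U)).op s := rfl

end ModuleMorphisms

/-! ### Coordinates on the pulled back bundle -/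

section Coordinates

variable {Q : Scheme.{0}} (q : Q ⟶ Plane) {M : Type} [AddCommGroup M] [Module PlaneRing M]

/-- Morphisms out of `E` are determined by their values on the elements of `M`. -/
theorem bundleSheaf_hom_ext {F : Plane.Modules} {φ ψ : bundleSheaf M ⟶ F}
    (h : ∀ m : M, φ.app ⊤ (globalSection M m) = ψ.app ⊤ (globalSection M m)) : φ = ψ := by
  apply ((tilde.adjunction (R := CommRingCat.of PlaneRing)).homEquiv _ _).injective
  ext m
  exact h m

/-- Morphisms out of `q^* E` are determined by their values on the elements of `M`. -/
theorem bundlePullback_hom_ext {F : Q.Modules} {φ ψ : bundlePullback q M ⟶ F}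
    (h : ∀ m : M, φ.app (q ⁻¹ᵁ ⊤) (pullbackGlobalSection q M m) =
      ψ.app (q ⁻¹ᵁ ⊤) (pullbackGlobalSection q M m)) : φ = ψ := by
  apply ((Scheme.Modules.pullbackPushforwardAdjunction q).homEquiv _ _).injective
  apply bundleSheaf_hom_ext
  intro m
  rw [Adjunction.homEquiv_unit, Adjunction.homEquiv_unit]
  exact h m

/-- The morphism `q^* E ⟶ 𝒪` induced by a linear form on `M`. -/
def coordMorphism (l : M →ₗ[PlaneRing] PlaneRing) : bundlePullback q M ⟶ unitModule Q :=
  ((Scheme.Modules.pullbackPushforwardAdjunction q).homEquiv _ _).symm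
    (tilde.map (R := CommRingCat.of PlaneRing) (ModuleCat.ofHom (X := M) (Y := PlaneRing) l) ≫
      (SheafOfModules.unitToPushforwardObjUnit q.toRingCatSheafHom :))

/-- The linear form on sections of `q^* E` induced by a linear form on `M`. -/
def coordSection (l : M →ₗ[PlaneRing] PlaneRing) (V : Q.Opens) :
    Γ(bundlePullback q M, V) →ₗ[Γ(Q, V)] Γ(Q, V) :=
  appLinear (coordMorphism q l) V

theorem coordMorphism_pullbackGlobalSection (l : M →ₗ[PlaneRing] PlaneRing) (m : M) :
    (coordMorphism q l).app (q ⁻¹ᵁ ⊤) (pullbackGlobalSection q M m) =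
      (q.app ⊤ ((Scheme.ΓSpecIso (CommRingCat.of PlaneRing)).inv (l m)) :) := by
  have h1 : pullbackUnit q M ≫ (Scheme.Modules.pushforward q).map (coordMorphism q l) =
      tilde.map (R := CommRingCat.of PlaneRing) (ModuleCat.ofHom (X := M) (Y := PlaneRing) l) ≫
      (SheafOfModules.unitToPushforwardObjUnit q.toRingCatSheafHom :) :=
    (Adjunction.homEquiv_unit ..).symm.trans (Equiv.apply_symm_apply _ _)
  have h2 := congr(($h1).app ⊤ (globalSection M m))
  have h3 := congr($(tilde.toOpen_map_app (R := CommRingCat.of PlaneRing)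
    (ModuleCat.ofHom (X := M) (Y := PlaneRing) l) ⊤) m)
  refine h2.trans ?_
  exact congrArg (q.app ⊤) h3

/-- The homomorphism `f ↦ q^* f`. -/
def pullbackFunctionHom (V : Q.Opens) : PlaneRing →+* Γ(Q, V) :=
  (q.appLE ⊤ V (le_preimage_top q V)).hom.comp
    (Scheme.ΓSpecIso (CommRingCat.of PlaneRing)).inv.hom

theorem pullbackFunctionHom_apply (V : Q.Opens) (f : PlaneRing) :
    pullbackFunctionHom q V f = pullbackFunction q V f := rfl

theorem pullbackSection_add (V : Q.Opens) (m n : M) :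
    pullbackSection q V (m + n) = pullbackSection q V m + pullbackSection q V n := by
  have h : globalSection M (m + n) = globalSection M m + globalSection M n :=
    map_add (tilde.toOpen (ModuleCat.of (CommRingCat.of PlaneRing) M) ⊤).hom m n
  have h' : pullbackGlobalSection q M (m + n) =
      pullbackGlobalSection q M m + pullbackGlobalSection q M n := by
    rw [pullbackGlobalSection, h, map_add]
    rfl
  rw [pullbackSection, h', map_add]
  rfl

theorem pullbackSection_sum {ι : Type} (t : Finset ι) (V : Q.Opens) (m : ι → M) :
    pullbackSection q V (∑ k ∈ t, m k) = ∑ k ∈ t, pullbackSection q V (m k) := by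
  let φ : M →+ Γ(bundlePullback q M, V) :=
    AddMonoidHom.mk' (pullbackSection q V) (pullbackSection_add q V)
  exact map_sum φ m t

theorem pullbackSection_smul (V : Q.Opens) (f : PlaneRing) (m : M) :
    pullbackSection q V (f • m) = pullbackFunction q V f • pullbackSection q V m := by
  have h1 : globalSection M (f • m) =
      (Scheme.ΓSpecIso (CommRingCat.of PlaneRing)).inv f • globalSection M m :=
    map_smul (tilde.toOpen (ModuleCat.of (CommRingCat.of PlaneRing) M) ⊤).hom f m
  have h2 : pullbackGlobalSection q M (f • m) =
      q.app ⊤ ((Scheme.ΓSpecIso (CommRingCat.of PlaneRing)).inv f) •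
        pullbackGlobalSection q M m := by
    rw [pullbackGlobalSection, h1, Scheme.Modules.Hom.app_smul]
    rfl
  rw [pullbackSection, h2, Scheme.Modules.map_smul, pullbackFunction, Scheme.Hom.app_eq_appLE,
    ← CategoryTheory.comp_apply (q.appLE _ _ _), Scheme.Hom.appLE_map]
  rfl

theorem coordSection_map (l : M →ₗ[PlaneRing] PlaneRing) {V V' : Q.Opens} (i : V' ⟶ V)
    (s : Γ(bundlePullback q M, V)) :
    coordSection q l V' ((bundlePullback q M).presheaf.map i.op s) =
      Q.presheaf.map i.op (coordSection q l V s) :=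
  app_map (coordMorphism q l) i s

theorem coordSection_pullbackSection (l : M →ₗ[PlaneRing] PlaneRing) (V : Q.Opens) (m : M) :
    coordSection q l V (pullbackSection q V m) = pullbackFunction q V (l m) := by
  rw [pullbackSection, coordSection_map]
  refine (congrArg (Q.presheaf.map _) (coordMorphism_pullbackGlobalSection q l m)).trans ?_
  rw [pullbackFunction, ← CategoryTheory.comp_apply, Scheme.Hom.app_eq_appLE,
    Scheme.Hom.appLE_map]

/-- The left side defines an endomorphism of `q^* E`. It fixes every `q^* m`, by expanding `m` in
the basis, and such sections determine a morphism, so it is the identity. -/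
theorem sum_coordSection_smul {ι : Type} [Fintype ι] (b : Module.Basis ι PlaneRing M)
    (V : Q.Opens) (s : Γ(bundlePullback q M, V)) :
    ∑ k, coordSection q (b.coord k) V s • pullbackSection q V (b k) = s := by
  let φ : bundlePullback q M ⟶ bundlePullback q M := modulesHomMk
    (fun V => ∑ k, (coordSection q (b.coord k) V).smulRight (pullbackSection q V (b k)))
    (fun {U V} i x => by
      simp [LinearMap.sum_apply, map_sum, coordSection_map, map_pullbackSection])
  have hφ : φ = 𝟙 _ := by
    refine bundlePullback_hom_ext q fun m => ?_
    have e (V : Q.Opens) : ∑ k, coordSection q (b.coord k) V (pullbackSection q V m) •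
        pullbackSection q V (b k) = pullbackSection q V m := by
      simp only [coordSection_pullbackSection]
      conv_rhs => rw [← b.sum_repr m]
      simp only [pullbackSection_sum, pullbackSection_smul, Module.Basis.coord_apply]
    have h1 : pullbackSection q (q ⁻¹ᵁ ⊤) m = pullbackGlobalSection q M m := by
      rw [pullbackSection]
      exact ConcreteCategory.congr_hom ((bundlePullback q M).presheaf.map_id _) _
    rw [← h1, modulesHomMk_app, LinearMap.sum_apply]
    exact e (q ⁻¹ᵁ ⊤)
  have := congr(($hφ).app V s)
  simpa [φ, modulesHomMk_app] using this

end Coordinates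

/-! ### The relative connection in a frame -/

section Frame

variable {M : Type} [AddCommGroup M] [Module PlaneRing M] [Module ℂ M]
  [IsScalarTower ℂ PlaneRing M] (nabla : Connection M)

theorem Connection.component_smul (i : Fin 2) (f : PlaneRing) (m : M) :
    nabla.component i (f • m) = f • nabla.component i m + pderiv i f • m := by
  simp only [Connection.component, LinearMap.comp_apply, LinearMap.restrictScalars_apply,
    nabla.leibniz, map_add, map_smul]
  congr 1
  simp [contract]

variable {ι : Type} [Fintype ι] (b : Module.Basis ι PlaneRing M)

/-- The matrix of the component `∇ᵢ` in a basis of `M`. -/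
def Connection.matrix (i : Fin 2) : Matrix ι ι PlaneRing :=
  fun k l => b.coord k (nabla.component i (b l))

theorem Connection.coord_component (i : Fin 2) (m : M) (k : ι) :
    b.coord k (nabla.component i m) =
      pderiv i (b.coord k m) + ∑ l, nabla.matrix b i k l * b.coord l m := by
  classical
  conv_lhs => rw [← b.sum_repr m]
  simp only [map_sum, nabla.component_smul, map_add, map_smul, Finset.sum_add_distrib,
    Connection.matrix, smul_eq_mul, Module.Basis.coord_apply, b.repr_self, Finsupp.single_apply]
  rw [add_comm]
  simp [mul_comm]

variable {Q P : Scheme.{0}} (q : Q ⟶ Plane) (p : Q ⟶ P)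

/-- The relative differential, as an additive map. -/
def relD {W : P.Opens} {V : Q.Opens} (h : V ≤ p ⁻¹ᵁ W) : Γ(Q, V) →+ RelDifferentials p W V h :=
  AddMonoidHom.mk' (fun f => CommRingCat.KaehlerDifferential.d f)
    (fun f g => ModuleCat.Derivation.d_add _ f g)

theorem relD_apply {W : P.Opens} {V : Q.Opens} (h : V ≤ p ⁻¹ᵁ W) (f : Γ(Q, V)) :
    CommRingCat.KaehlerDifferential.d f = relD p h f := rfl

theorem relD_mul {W : P.Opens} {V : Q.Opens} (h : V ≤ p ⁻¹ᵁ W) (f g : Γ(Q, V)) :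
    relD p h (f * g) = f • relD p h g + g • relD p h f :=
  (CommRingCat.KaehlerDifferential.D (p.appLE W V h)).d_mul f g

theorem relD_appLE {W : P.Opens} {V : Q.Opens} (h : V ≤ p ⁻¹ᵁ W) (a : Γ(P, W)) :
    relD p h (p.appLE W V h a) = 0 :=
  (CommRingCat.KaehlerDifferential.D (p.appLE W V h)).d_map a

/-- The covariant derivative along the fibres of `p` in coordinates. -/
def coordDerivative (W : P.Opens) (V : Q.Opens) (h : V ≤ p ⁻¹ᵁ W) (u : ι → Γ(Q, V)) (k : ι) :
    RelDifferentials p W V h :=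
  relD p h (u k) + ∑ i, ∑ l, (pullbackFunction q V (nabla.matrix b i k l) * u l) •
    relD p h (pullbackFunction q V (X i))

/-- The chain rule. The schemes carry no chosen structure over `ℂ`, so `hc` supplies what is needed
of it: scalars come from the base of `p` and have zero relative differential. -/
theorem relD_pullbackFunction {W : P.Opens} {V : Q.Opens} (h : V ≤ p ⁻¹ᵁ W)
    (hc : ∀ c : ℂ, ∃ a, p.appLE W V h a = pullbackFunction q V (C c)) (f : PlaneRing) :
    relD p h (pullbackFunction q V f) =
      ∑ i, pullbackFunction q V (pderiv i f) • relD p h (pullbackFunction q V (X i)) := by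
  simp only [← pullbackFunctionHom_apply]
  induction f using MvPolynomial.induction_on with
  | C c =>
    obtain ⟨a, ha⟩ := hc c
    rw [pullbackFunctionHom_apply, ← ha, relD_appLE]
    simp
  | add f g hf hg =>
    simp only [map_add, hf, hg, add_smul, Finset.sum_add_distrib]
  | mul_X f j hf =>
    rw [map_mul, relD_mul, hf]
    simp only [Derivation.leibniz, map_add, smul_eq_mul, map_mul, add_smul,
      Finset.sum_add_distrib, mul_smul, ← Finset.smul_sum]
    congr 1
    rw [Fintype.sum_eq_single j]
    · simp
    · intro i hi
      simp [pderiv_X_of_ne hi.symm]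

/-- Taking the `k`-th coordinate of the `q^* E`-valued form gives an expression in the coordinates
of `s` alone, so horizontality does not depend on the chosen expression `∑ fₖ · q^* mₖ`. Conversely,
the expansion of `s` in the frame `q^* b` is one such expression. -/
theorem isHorizontalOn_iff {W : P.Opens} {V : Q.Opens} (h : V ≤ p ⁻¹ᵁ W)
    (hc : ∀ c : ℂ, ∃ a, p.appLE W V h a = pullbackFunction q V (C c))
    (s : Γ(bundlePullback q M, V)) :
    IsHorizontalOn q p nabla W V h s ↔
      ∀ k, coordDerivative nabla b q p W V h (fun l => coordSection q (b.coord l) V s) k = 0 := by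
  constructor
  · rintro ⟨n, f, m, rfl, h0⟩ k
    have h1 := congrArg ((TensorProduct.lid Γ(Q, V) (RelDifferentials p W V h)).toLinearMap ∘ₗ
      LinearMap.rTensor (RelDifferentials p W V h) (coordSection q (b.coord k) V)) h0
    rw [map_zero, map_sum] at h1
    -- The terms `∂ᵢ` of the coordinates of `∇ᵢ m` combine, by the chain rule, with the term in `df`
    -- to the differential of the product `f · q^* mₖ`.
    have key (f : Γ(Q, V)) (m : M) : ((TensorProduct.lid Γ(Q, V)
        (RelDifferentials p W V h)).toLinearMap ∘ₗ
          LinearMap.rTensor (RelDifferentials p W V h) (coordSection q (b.coord k) V))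
            (relDerivative q p nabla W V h f m) =
        relD p h (f * pullbackFunction q V (b.coord k m)) +
          ∑ i, ∑ l, (pullbackFunction q V (nabla.matrix b i k l) *
            (f * pullbackFunction q V (b.coord l m))) • relD p h (pullbackFunction q V (X i)) := by
      simp only [relDerivative, map_add, map_sum, LinearMap.comp_apply, LinearMap.rTensor_tmul,
        LinearEquiv.coe_coe, TensorProduct.lid_tmul, map_smul, coordSection_pullbackSection,
        nabla.coord_component b, smul_eq_mul, relD_apply, relD_mul]
      rw [relD_pullbackFunction q p h hc (b.coord k m)]
      rw [add_comm (f • _), add_assoc]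
      congr 1
      rw [Finset.smul_sum, ← Finset.sum_add_distrib]
      refine Finset.sum_congr rfl fun i _ => ?_
      simp only [← pullbackFunctionHom_apply, map_add, map_sum, map_mul]
      rw [mul_add, add_smul, mul_smul, Finset.mul_sum, Finset.sum_smul]
      congr 1
      refine Finset.sum_congr rfl fun l _ => ?_
      rw [mul_left_comm]
    simp only [key, Finset.sum_add_distrib] at h1
    rw [← h1, coordDerivative]
    simp only [map_sum, map_smul, coordSection_pullbackSection, smul_eq_mul, Finset.mul_sum,
      Finset.sum_smul]
    congr 1
    conv_rhs => rw [Finset.sum_comm]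
    refine Finset.sum_congr rfl fun i _ => ?_
    rw [Finset.sum_comm]
  · intro h0
    refine ⟨Fintype.card ι, fun a => coordSection q (b.coord ((Fintype.equivFin ι).symm a)) V s,
      fun a => b ((Fintype.equivFin ι).symm a), ?_, ?_⟩
    · rw [(Fintype.equivFin ι).symm.sum_comp fun k => coordSection q (b.coord k) V s •
        pullbackSection q V (b k), sum_coordSection_smul]
    · rw [(Fintype.equivFin ι).symm.sum_comp fun k => relDerivative q p nabla W V h
        (coordSection q (b.coord k) V s) (b k)]
      have h1 : ∀ k, pullbackSection q V (b k) ⊗ₜ[Γ(Q, V)] coordDerivative nabla b q p W V h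
          (fun l => coordSection q (b.coord l) V s) k = 0 := by
        intro k
        rw [h0, TensorProduct.tmul_zero]
      rw [← Finset.sum_eq_zero (fun k (_ : k ∈ Finset.univ) => h1 k)]
      have h2 (i : Fin 2) (l : ι) : pullbackSection q V (nabla.component i (b l)) =
          ∑ k, pullbackFunction q V (nabla.matrix b i k l) • pullbackSection q V (b k) := by
        conv_lhs => rw [← b.sum_repr (nabla.component i (b l))]
        simp only [pullbackSection_sum, pullbackSection_smul]
        rfl
      simp only [relDerivative, coordDerivative, relD_apply, h2, TensorProduct.tmul_add,
        Finset.sum_add_distrib, TensorProduct.tmul_sum]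
      congr 1
      rw [Finset.sum_comm]
      conv_rhs => rw [Finset.sum_comm]
      refine Finset.sum_congr rfl fun i _ => ?_
      simp only [Finset.smul_sum, TensorProduct.sum_tmul]
      rw [Finset.sum_comm]
      refine Finset.sum_congr rfl fun k _ => Finset.sum_congr rfl fun l _ => ?_
      rw [smul_smul, mul_comm, TensorProduct.smul_tmul]

end Frame

/-! ### Strictly triangular linear differential systems -/

section LinearODE

/-- A linear differential system whose matrix is strictly triangular has an invertible solution
matrix as soon as every function has a primitive. -/
theorem exists_isUnit_solution {S ι : Type} [CommRing S] [Fintype ι] [DecidableEq ι] (D : S →+ S)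
    (hD1 : D 1 = 0) (hD : Function.Surjective D) (N : Matrix ι ι S) (w : ι → ℤ)
    (hN : ∀ j k, N j k ≠ 0 → w j < w k) :
    ∃ G : Matrix ι ι S, IsUnit G ∧ ∀ j k, D (G j k) + ∑ l, N j l * G l k = 0 := by
  classical
  obtain ⟨E₀, hE₀⟩ := hD.hasRightInverse
  -- A choice of primitives that sends `0` to `0`, so that integrating a matrix entrywise preserves
  -- its zero pattern.
  let E : S → S := fun x => if x = 0 then 0 else E₀ x
  have hE0 : E 0 = 0 := if_pos rfl
  have hE (x : S) : D (E x) = x := by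
    by_cases hx : x = 0
    · simp [E, hx]
    · simp only [E, if_neg hx]; exact hE₀ x
  -- Picard iterates: `H 0 = 1` and `D (H (n+1)) = -N * H n`. No product is ever differentiated, so
  -- additivity of `D` suffices.
  let H : ℕ → Matrix ι ι S := fun n => Nat.rec 1 (fun _ A => (-(N * A)).map E) n
  have hHs (n : ℕ) : H (n + 1) = (-(N * H n)).map E := rfl
  have hmul {A B : Matrix ι ι S} {m n : ℤ} (hA : ∀ j k, A j k ≠ 0 → w j + m ≤ w k)
      (hB : ∀ j k, B j k ≠ 0 → w j + n ≤ w k) (j k : ι) (h : (A * B) j k ≠ 0) :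
      w j + (m + n) ≤ w k := by
    rw [Matrix.mul_apply] at h
    obtain ⟨l, -, hl⟩ := Finset.exists_ne_zero_of_sum_ne_zero h
    have h1 := hA j l (left_ne_zero_of_mul hl)
    have h2 := hB l k (right_ne_zero_of_mul hl)
    omega
  have hN' : ∀ j k, N j k ≠ 0 → w j + 1 ≤ w k := fun j k h => hN j k h
  have hone : ∀ j k, (1 : Matrix ι ι S) j k ≠ 0 → w j + 0 ≤ w k := by
    intro j k h
    by_cases hjk : j = k
    · subst hjk; simp
    · exact (h (Matrix.one_apply_ne hjk)).elim
  have hH (n : ℕ) : ∀ j k, H n j k ≠ 0 → w j + (n : ℤ) ≤ w k := by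
    induction n with
    | zero => exact hone
    | succ n ih =>
      intro j k h
      rw [hHs, Matrix.map_apply, Matrix.neg_apply] at h
      have := hmul hN' ih j k (fun h0 => h (by rw [h0, neg_zero, hE0]))
      push_cast
      linarith
  -- `L` exceeds every weight gap, so a matrix whose nonzero entries raise `w` by at least `L`
  -- vanishes. This kills both `H L` and `K ^ L`.
  obtain ⟨L, hL⟩ : ∃ L : ℕ, ∀ j k, w k < w j + L := by
    refine ⟨∑ j, ∑ k, ((w k - w j).toNat + 1), fun j k => ?_⟩
    have h1 := Finset.single_le_sum (f := fun j => ∑ k, ((w k - w j).toNat + 1))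
      (fun _ _ => Nat.zero_le _) (Finset.mem_univ j)
    have h2 := Finset.single_le_sum (f := fun k => ((w k - w j).toNat + 1))
      (fun _ _ => Nat.zero_le _) (Finset.mem_univ k)
    have h3 := h2.trans h1
    have h4 := (w k - w j).self_le_toNat
    have h5 : ((w k - w j).toNat : ℤ) + 1 ≤
        ((∑ j, ∑ k, ((w k - w j).toNat + 1) : ℕ) : ℤ) := by exact_mod_cast h3
    omega
  have hzero {A : Matrix ι ι S} {n : ℤ} (hn : (L : ℤ) ≤ n)
      (hA : ∀ j k, A j k ≠ 0 → w j + n ≤ w k) : A = 0 := by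
    ext j k
    by_contra h
    have h1 := hA j k h
    have h2 := hL j k
    omega
  obtain ⟨K, hKdef⟩ : ∃ K : Matrix ι ι S, K = ∑ n ∈ Finset.range L, H (n + 1) := ⟨_, rfl⟩
  have hK : ∀ j k, K j k ≠ 0 → w j + 1 ≤ w k := by
    intro j k h
    rw [hKdef, Matrix.sum_apply] at h
    obtain ⟨n, -, hn⟩ := Finset.exists_ne_zero_of_sum_ne_zero h
    have := hH (n + 1) j k hn
    push_cast at this
    omega
  have hKpow (n : ℕ) : ∀ j k, (K ^ n) j k ≠ 0 → w j + (n : ℤ) ≤ w k := by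
    induction n with
    | zero => rw [pow_zero]; exact hone
    | succ n ih =>
      rw [pow_succ]
      push_cast
      exact hmul ih hK
  refine ⟨1 + K, IsNilpotent.isUnit_one_add ⟨L, hzero le_rfl (hKpow L)⟩, fun j k => ?_⟩
  have hD1K : D ((1 + K) j k) = D (K j k) := by
    rw [Matrix.add_apply, map_add]
    by_cases hjk : j = k
    · subst hjk; simp [hD1]
    · simp [Matrix.one_apply_ne hjk]
  have h1K : 1 + K = ∑ n ∈ Finset.range (L + 1), H n := by
    rw [Finset.sum_range_succ', add_comm, hKdef]
    rfl
  have hDK : D (K j k) = -(N * (∑ n ∈ Finset.range L, H n)) j k := by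
    rw [hKdef, Matrix.sum_apply, map_sum, Finset.mul_sum, Matrix.sum_apply, ← Finset.sum_neg_distrib]
    refine Finset.sum_congr rfl fun n _ => ?_
    rw [hHs, Matrix.map_apply, hE, Matrix.neg_apply]
  -- `1 + K` is the sum of `H n` for `n ≤ L`, while its derivative involves only `n < L`; the
  -- discrepancy is `N * H L = 0`.
  have hlast : H L = 0 := hzero le_rfl (hH L)
  rw [hD1K, hDK, ← Matrix.mul_apply, h1K, Finset.sum_range_succ, hlast, add_zero, neg_add_cancel]

end LinearODE

/-! ### Differentiation along a polynomial coordinate -/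

section PolynomialDerivation

open Polynomial in
theorem derivative_surjective {B : Type} [CommRing B] (hB : ∀ n : ℕ, IsUnit ((n + 1 : ℕ) : B)) :
    Function.Surjective (derivative : B[X] → B[X]) := by
  intro F
  induction F using Polynomial.induction_on' with
  | add f g hf hg =>
    obtain ⟨f', rfl⟩ := hf
    obtain ⟨g', rfl⟩ := hg
    exact ⟨f' + g', by simp⟩
  | monomial n a =>
    obtain ⟨u, hu⟩ := hB n
    refine ⟨monomial (n + 1) (a * ↑u⁻¹), ?_⟩
    rw [derivative_monomial, Nat.add_sub_cancel, ← hu, mul_assoc, Units.inv_mul, mul_one]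

variable {B S : Type} [CommRing B] [CommRing S] [Algebra B S] (τ : S)

/-- The derivation `d/dτ` of a polynomial algebra `B[τ]`. -/
def polyDerivation (hτ : Function.Bijective (Polynomial.aeval (R := B) τ)) : Derivation B S S :=
  let e := AlgEquiv.ofBijective (Polynomial.aeval (R := B) τ) hτ
  Derivation.mk' (e.toLinearMap ∘ₗ Polynomial.derivative ∘ₗ e.symm.toLinearMap) (by
    intro x y
    obtain ⟨f, rfl⟩ := e.surjective x
    obtain ⟨g, rfl⟩ := e.surjective y
    simp only [LinearMap.comp_apply, AlgEquiv.toLinearMap_apply, map_mul, AlgEquiv.symm_apply_apply,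
      Polynomial.derivative_mul, map_add, smul_eq_mul]
    ring)

theorem polyDerivation_aeval (hτ : Function.Bijective (Polynomial.aeval (R := B) τ))
    (F : Polynomial B) : polyDerivation τ hτ (Polynomial.aeval τ F) =
      Polynomial.aeval τ (Polynomial.derivative F) := by
  let e := AlgEquiv.ofBijective (Polynomial.aeval (R := B) τ) hτ
  change e (Polynomial.derivative (e.symm (e F))) = _
  rw [AlgEquiv.symm_apply_apply]
  rfl

theorem polyDerivation_surjective (hτ : Function.Bijective (Polynomial.aeval (R := B) τ))
    (hB : ∀ n : ℕ, IsUnit ((n + 1 : ℕ) : B)) : Function.Surjective (polyDerivation τ hτ) := by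
  intro x
  obtain ⟨F, rfl⟩ := hτ.surjective x
  obtain ⟨G, rfl⟩ := derivative_surjective hB F
  exact ⟨_, polyDerivation_aeval τ hτ G⟩

/-- A derivation extends to a localization. -/
theorem exists_derivation_localization {T : Type} [CommRing T] [Algebra B T] [Algebra S T]
    [IsScalarTower B S T] (c : Submonoid S) [IsLocalization c T] (δ : Derivation B S S) :
    ∃ δ' : Derivation B T T, ∀ s, δ' (algebraMap S T s) = algebraMap S T (δ s) := by
  -- Localization is formally étale, so differentials of `T` are the base change of those of `S`,
  -- and the linear form attached to `δ` extends.
  have := Algebra.FormallyEtale.of_isLocalization (Rₘ := T) c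
  let l : Ω[S⁄B] →ₗ[S] T := ((Algebra.linearMap S T).compDer δ).liftKaehlerDifferential
  have hb := KaehlerDifferential.isBaseChange_of_formallyEtale B S T
  refine ⟨(hb.lift l).compDer (KaehlerDifferential.D B T), fun s => ?_⟩
  have := hb.lift_eq l (KaehlerDifferential.D B S s)
  simp only [KaehlerDifferential.map_D] at this
  refine this.trans ?_
  simp [l]

end PolynomialDerivation

/-! ### Line charts and the gauge transformation -/

/-- An affine open set `W` of the base over which `p` is a trivial bundle of affine lines with
coordinate `τ`, in which the functions `q^* tᵢ` are affine linear. -/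
structure LineChart {Q P : Scheme.{0}} (q : Q ⟶ Plane) (p : Q ⟶ P) (W : P.Opens) where
  isAffineOpen : IsAffineOpen W
  isAffineOpen_preimage : IsAffineOpen (p ⁻¹ᵁ W)
  isDomain : IsDomain Γ(P, W)
  τ : Γ(Q, p ⁻¹ᵁ W)
  bijective : Function.Bijective (Polynomial.eval₂RingHom (p.app W).hom τ)
  const (c : ℂ) : ∃ a, p.app W a = pullbackFunction q (p ⁻¹ᵁ W) (C c)
  intercept : Fin 2 → Γ(P, W)
  slope : Fin 2 → Γ(P, W)
  pullback_X (i : Fin 2) : pullbackFunction q (p ⁻¹ᵁ W) (X i) =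
    p.app W (intercept i) + p.app W (slope i) * τ

namespace LineChart

variable {Q P : Scheme.{0}} {q : Q ⟶ Plane} {p : Q ⟶ P} {W : P.Opens} (χ : LineChart q p W)

/-- Restriction of functions to an open subset. -/
abbrev res {Y : Scheme.{0}} {U V : Y.Opens} (h : V ≤ U) : Γ(Y, U) →+* Γ(Y, V) :=
  (Y.presheaf.map (homOfLE h).op).hom

theorem res_res {Y : Scheme.{0}} {U V T : Y.Opens} (h : V ≤ U) (h' : T ≤ V) (f : Γ(Y, U)) :
    res h' (res h f) = res (h'.trans h) f := by
  change (Y.presheaf.map _ ≫ Y.presheaf.map _) f = _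
  rw [← Functor.map_comp]
  rfl

theorem res_appLE {W' W'' : P.Opens} {V V' : Q.Opens} (h : V ≤ p ⁻¹ᵁ W') (h' : V' ≤ V)
    (hW : W'' ≤ W') (hV : V' ≤ p ⁻¹ᵁ W'') (a : Γ(P, W')) :
    res h' (p.appLE W' V h a) = p.appLE W'' V' hV (res hW a) := by
  change (p.appLE W' V h ≫ Q.presheaf.map _) a = (P.presheaf.map _ ≫ p.appLE _ _ _) a
  rw [Scheme.Hom.appLE_map, Scheme.Hom.map_appLE]

theorem res_pullbackFunction {V V' : Q.Opens} (h : V' ≤ V) (f : PlaneRing) :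
    res h (pullbackFunction q V f) = pullbackFunction q V' f :=
  map_pullbackFunction q (homOfLE h) f

/-- The derivation `d/dτ`. -/
def deriv : Γ(Q, p ⁻¹ᵁ W) →+ Γ(Q, p ⁻¹ᵁ W) :=
  letI := (p.app W).hom.toAlgebra
  (polyDerivation (B := Γ(P, W)) χ.τ χ.bijective).toLinearMap.toAddMonoidHom

theorem deriv_eval₂ (F : Polynomial Γ(P, W)) :
    χ.deriv (Polynomial.eval₂ (p.app W).hom χ.τ F) =
      Polynomial.eval₂ (p.app W).hom χ.τ (Polynomial.derivative F) :=
  letI := (p.app W).hom.toAlgebra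
  polyDerivation_aeval (B := Γ(P, W)) χ.τ χ.bijective F

theorem deriv_one : χ.deriv 1 = 0 := by
  simpa using χ.deriv_eval₂ 1

theorem app_injective (χ : LineChart q p W) : Function.Injective (p.app W).hom := by
  intro a b hab
  have := χ.bijective.injective (a₁ := Polynomial.C a) (a₂ := Polynomial.C b) (by simpa using hab)
  exact Polynomial.C_injective this

/-- The complex scalar `1/(n+1)` comes from the base by `const`, and injectivity of pullback moves
the identity down. This is where characteristic zero enters the chart. -/
theorem isUnit_natCast (χ : LineChart q p W) (n : ℕ) : IsUnit ((n + 1 : ℕ) : Γ(P, W)) := by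
  obtain ⟨a, ha⟩ := χ.const ((n + 1 : ℕ) : ℂ)⁻¹
  refine IsUnit.of_mul_eq_one a (χ.app_injective ?_)
  rw [map_mul, map_one, map_natCast]
  change _ * (p.app W) a = 1
  rw [ha, ← pullbackFunctionHom_apply, ← map_natCast (pullbackFunctionHom q (p ⁻¹ᵁ W)), ← map_mul,
    ← map_natCast (C : ℂ →+* PlaneRing), ← C_mul, mul_inv_cancel₀ (Nat.cast_ne_zero.mpr n.succ_ne_zero),
    C_1, map_one]

theorem deriv_surjective : Function.Surjective χ.deriv :=
  letI := (p.app W).hom.toAlgebra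
  polyDerivation_surjective (B := Γ(P, W)) χ.τ χ.bijective χ.isUnit_natCast

/-- The rule `ds = (ds/dτ) dτ` for polynomials in `τ`, whose coefficients come from the base and
have zero differential. It is needed on arbitrary smaller opens because horizontality is tested
locally. -/
theorem relD_res {W' : P.Opens} {V : Q.Opens} (h : V ≤ p ⁻¹ᵁ W') (hW : W' ≤ W)
    (hV : V ≤ p ⁻¹ᵁ W) (s : Γ(Q, p ⁻¹ᵁ W)) :
    relD p h (res hV s) = res hV (χ.deriv s) • relD p h (res hV χ.τ) := by
  have hb (a : Γ(P, W)) : relD p h (res hV ((p.app W).hom a)) = 0 := by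
    have := res_appLE (le_refl (p ⁻¹ᵁ W)) hV hW h a
    rw [← Scheme.Hom.app_eq_appLE] at this
    change relD p h (res hV (p.app W a)) = 0
    rw [this, relD_appLE]
  obtain ⟨F, rfl⟩ := χ.bijective.surjective s
  rw [Polynomial.coe_eval₂RingHom, deriv_eval₂]
  induction F using Polynomial.induction_on' with
  | add f g hf hg =>
    simp only [Polynomial.eval₂_add, map_add, hf, hg, add_smul]
  | monomial n a =>
    induction n generalizing a with
    | zero => simp [hb]
    | succ n ih =>
      have h1 : Polynomial.eval₂ (p.app W).hom χ.τ (Polynomial.monomial (n + 1) a) =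
          Polynomial.eval₂ (p.app W).hom χ.τ (Polynomial.monomial n a) * χ.τ := by
        rw [Polynomial.eval₂_monomial, Polynomial.eval₂_monomial, pow_succ, mul_assoc]
      have h2 : Polynomial.derivative (Polynomial.monomial (n + 1) a) =
          Polynomial.derivative (Polynomial.monomial n a) * Polynomial.X +
            Polynomial.monomial n a := by
        rw [← Polynomial.monomial_mul_X, Polynomial.derivative_mul, Polynomial.derivative_X,
          mul_one]
      rw [h1, h2, map_mul, relD_mul, ih, Polynomial.eval₂_add, Polynomial.eval₂_mul_X, map_add,
        map_mul, add_smul, smul_smul, add_comm, mul_comm]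

section Gauge

variable {M : Type} [AddCommGroup M] [Module PlaneRing M] [Module ℂ M]
  [IsScalarTower ℂ PlaneRing M] (nabla : Connection M) {ι : Type} [Fintype ι]
  (b : Module.Basis ι PlaneRing M)

/-- The matrix of the relative connection in the chart, with respect to `dτ`. -/
def relMatrix : Matrix ι ι Γ(Q, p ⁻¹ᵁ W) := fun k l =>
  ∑ i, pullbackFunction q (p ⁻¹ᵁ W) (nabla.matrix b i k l) * p.app W (χ.slope i)

theorem exists_gauge [DecidableEq ι] (w : ι → ℤ) (hw : ∀ i k l, nabla.matrix b i k l ≠ 0 → w k < w l) :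
    ∃ G : Matrix ι ι Γ(Q, p ⁻¹ᵁ W), IsUnit G ∧
      ∀ k l, χ.deriv (G k l) + ∑ j, χ.relMatrix nabla b k j * G j l = 0 := by
  refine exists_isUnit_solution χ.deriv χ.deriv_one χ.deriv_surjective _ w fun k l h => ?_
  obtain ⟨i, -, hi⟩ := Finset.exists_ne_zero_of_sum_ne_zero h
  refine hw i k l fun h0 => left_ne_zero_of_mul hi ?_
  rw [h0, ← pullbackFunctionHom_apply, map_zero]

variable {G : Matrix ι ι Γ(Q, p ⁻¹ᵁ W)}

/-- With `N` the relative matrix, the Leibniz rule gives `(G' + N G) f dτ + G df`, and the first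
term vanishes by the choice of `G`. -/
theorem coordDerivative_gauge
    (hG : ∀ k l, χ.deriv (G k l) + ∑ j, χ.relMatrix nabla b k j * G j l = 0)
    {W' : P.Opens} {V : Q.Opens} (h : V ≤ p ⁻¹ᵁ W') (hW : W' ≤ W) (hV : V ≤ p ⁻¹ᵁ W) (f : ι → Γ(Q, V)) (k : ι) :
    coordDerivative nabla b q p W' V h (fun l => ∑ j, res hV (G l j) * f j) k =
      ∑ j, res hV (G k j) • relD p h (f j) := by
  have hX (i : Fin 2) : relD p h (pullbackFunction q V (X i)) =
      res hV (p.app W (χ.slope i)) • relD p h (res hV χ.τ) := by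
    rw [← res_pullbackFunction hV, χ.relD_res h hW hV, χ.pullback_X i]
    congr 2
    have := χ.deriv_eval₂ (Polynomial.C (χ.intercept i) + Polynomial.C (χ.slope i) * Polynomial.X)
    simpa using this
  have hN (l : ι) : ∑ i, pullbackFunction q V (nabla.matrix b i k l) *
      res hV (p.app W (χ.slope i)) = res hV (χ.relMatrix nabla b k l) := by
    simp only [relMatrix, map_sum, map_mul, res_pullbackFunction]
  have h2 : ∑ i, ∑ l, (pullbackFunction q V (nabla.matrix b i k l) *
      ∑ j, res hV (G l j) * f j) • relD p h (pullbackFunction q V (X i)) =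
      ∑ j, (f j * res hV (∑ l, χ.relMatrix nabla b k l * G l j)) • relD p h (res hV χ.τ) := by
    simp only [hX, smul_smul, ← Finset.sum_smul]
    congr 1
    rw [Finset.sum_comm]
    simp only [map_sum, map_mul, ← hN, Finset.mul_sum, Finset.sum_mul]
    conv_rhs => rw [Finset.sum_comm]
    refine Finset.sum_congr rfl fun l _ => ?_
    rw [Finset.sum_comm]
    refine Finset.sum_congr rfl fun j _ => Finset.sum_congr rfl fun i _ => ?_
    ring
  rw [coordDerivative, h2, map_sum]
  simp only [relD_mul, Finset.sum_add_distrib]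
  rw [add_assoc, ← Finset.sum_add_distrib]
  refine (add_eq_left.mpr (Finset.sum_eq_zero fun j _ => ?_))
  rw [χ.relD_res h hW hV, smul_smul, ← add_smul, ← mul_add, ← map_add, hG, map_zero, mul_zero,
    zero_smul]

/-- In the frame given by the columns of `G`, a section is horizontal if and only if its
coordinates are constant along the fibres. -/
theorem isHorizontalOn_iff_relD [DecidableEq ι]
    (hG : ∀ k l, χ.deriv (G k l) + ∑ j, χ.relMatrix nabla b k j * G j l = 0)
    (hu : IsUnit G) {W' : P.Opens} {V : Q.Opens} (h : V ≤ p ⁻¹ᵁ W') (hW : W' ≤ W)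
    (hV : V ≤ p ⁻¹ᵁ W) (s : Γ(bundlePullback q M, V)) (f : ι → Γ(Q, V))
    (hs : ∀ k, coordSection q (b.coord k) V s = ∑ j, res hV (G k j) * f j) :
    IsHorizontalOn q p nabla W' V h s ↔ ∀ j, relD p h (f j) = 0 := by
  have hc (c : ℂ) : ∃ a, p.appLE W' V h a = pullbackFunction q V (C c) := by
    obtain ⟨a, ha⟩ := χ.const c
    refine ⟨res hW a, ?_⟩
    rw [← res_appLE (le_refl (p ⁻¹ᵁ W)) hV hW h a, ← Scheme.Hom.app_eq_appLE, ha,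
      res_pullbackFunction]
  rw [isHorizontalOn_iff nabla b q p h hc]
  simp only [hs, χ.coordDerivative_gauge nabla b hG h hW hV]
  constructor
  · intro h0 j
    obtain ⟨⟨G', H, h1, h2⟩, rfl⟩ := hu
    have h3 : ∑ k, res hV (H j k) • ∑ l, res hV (G' k l) • relD p h (f l) = 0 :=
      Finset.sum_eq_zero fun k _ => by
        rw [show ∑ l, res hV (G' k l) • relD p h (f l) = 0 from h0 k, smul_zero]
    simp only [Finset.smul_sum, smul_smul, ← map_mul] at h3
    rw [Finset.sum_comm] at h3
    simp only [← Finset.sum_smul, ← map_sum, ← Matrix.mul_apply, h2, Matrix.one_apply] at h3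
    rw [Finset.sum_eq_single j (fun l _ hl => by rw [if_neg hl.symm, map_zero, zero_smul])
      (fun hj => (hj (Finset.mem_univ j)).elim), if_pos rfl, map_one, one_smul] at h3
    exact h3
  · intro h0 k
    simp only [h0, smul_zero, Finset.sum_const_zero]

end Gauge

end LineChart

/-! ### Functions constant along the fibres -/

namespace LineChart

theorem exists_pow_mul_res_eq {Y : Scheme.{0}} {U V : Y.Opens} (hU : IsAffineOpen U) (f : Γ(Y, U))
    (hV : V = Y.basicOpen f) (h : V ≤ U) (x : Γ(Y, V)) :
    ∃ (n : ℕ) (a : Γ(Y, U)), res h f ^ n * x = res h a := by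
  let := (Y.presheaf.map (homOfLE h).op).hom.toAlgebra
  have := hU.isLocalization_of_eq_basicOpen f (homOfLE h) hV
  obtain ⟨n, a, ha⟩ := IsLocalization.Away.surj f x
  refine ⟨n, a, ?_⟩
  rw [mul_comm]
  exact ha

theorem exists_pow_mul_eq_zero {Y : Scheme.{0}} {U V : Y.Opens} (hU : IsAffineOpen U)
    (f : Γ(Y, U)) (hV : V = Y.basicOpen f) (h : V ≤ U) (a : Γ(Y, U)) (ha : res h a = 0) :
    ∃ n : ℕ, f ^ n * a = 0 := by
  let := (Y.presheaf.map (homOfLE h).op).hom.toAlgebra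
  have := hU.isLocalization_of_eq_basicOpen f (homOfLE h) hV
  obtain ⟨⟨_, n, rfl⟩, hn⟩ := (IsLocalization.map_eq_zero_iff (Submonoid.powers f) Γ(Y, V) a).mp ha
  exact ⟨n, hn⟩

theorem isUnit_res {Y : Scheme.{0}} {U V : Y.Opens} (f : Γ(Y, U))
    (hV : V = Y.basicOpen f) (h : V ≤ U) : IsUnit (res h f) := by
  subst hV
  exact RingedSpace.isUnit_res_basicOpen _ f

theorem eq_of_locally_eq {Y : Scheme.{0}} {U : Y.Opens} (f g : Γ(Y, U))
    (H : ∀ x ∈ U, ∃ (V : Y.Opens) (h : V ≤ U), x ∈ V ∧ res h f = res h g) : f = g := by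
  choose V h hx he using H
  refine TopCat.Sheaf.eq_of_locally_eq' Y.sheaf (fun x : U => V x x.2) U
    (fun x => homOfLE (h x x.2)) (fun x hxU => ?_) f g (fun x => he x x.2)
  exact TopologicalSpace.Opens.mem_iSup.mpr ⟨⟨x, hxU⟩, hx x hxU⟩

variable {Q P : Scheme.{0}} {q : Q ⟶ Plane} {p : Q ⟶ P} {W : P.Opens}

theorem app_res {U U' : P.Opens} (h : U' ≤ U) (a : Γ(P, U)) :
    p.app U' (res h a) = res (p.preimage_mono h) (p.app U a) := by
  have := res_appLE (p := p) (le_refl (p ⁻¹ᵁ U)) (p.preimage_mono h) h le_rfl a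
  rw [← Scheme.Hom.app_eq_appLE, ← Scheme.Hom.app_eq_appLE] at this
  exact this.symm

theorem isDomain_preimage (χ : LineChart q p W) : IsDomain Γ(Q, p ⁻¹ᵁ W) :=
  have := χ.isDomain
  MulEquiv.isDomain _ (RingEquiv.ofBijective _ χ.bijective).symm.toMulEquiv

/-- Pullback of functions along the fibration is injective. -/
theorem app_injective_of_le (χ : LineChart q p W) {U : P.Opens} (hU : U ≤ W) :
    Function.Injective (p.app U) := by
  refine (injective_iff_map_eq_zero (p.app U).hom).mpr fun g hg => ?_
  change p.app U g = 0 at hg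
  refine eq_of_locally_eq _ _ fun x hx => ?_
  obtain ⟨b, hbU, hxb⟩ := χ.isAffineOpen.exists_basicOpen_le ⟨x, hx⟩ (hU hx)
  refine ⟨P.basicOpen b, hbU, hxb, ?_⟩
  have hbW := P.basicOpen_le b
  -- Injectivity is known over `W` only, so `g` is replaced by `bⁿ g`, which extends to a function
  -- on `W`.
  obtain ⟨n, a, ha⟩ := exists_pow_mul_res_eq χ.isAffineOpen b rfl hbW (res hbU g)
  have h1 : res (p.preimage_mono hbW) (p.app W a) = 0 := by
    rw [← app_res hbW, ← ha, map_mul, app_res hbU, hg, map_zero, mul_zero]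
  obtain ⟨m, hm⟩ := exists_pow_mul_eq_zero χ.isAffineOpen_preimage (p.app W b)
    (p.preimage_basicOpen b) (p.preimage_mono hbW) _ h1
  have h2 : b ^ m * a = 0 := χ.app_injective (by rw [map_mul, map_pow, map_zero]; exact hm)
  have h3 := congrArg (res hbW) h2
  rw [map_mul, ← ha, map_pow, map_zero, ← mul_assoc, ← pow_add] at h3
  rw [map_zero]
  exact (((isUnit_res b rfl hbW).pow _).mul_right_eq_zero).mp h3

theorem relD_restrict {W₁ W₂ : P.Opens} {V₁ V₂ : Q.Opens} (h₁ : V₁ ≤ p ⁻¹ᵁ W₁)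
    (h₂ : V₂ ≤ p ⁻¹ᵁ W₂) (hV : V₂ ≤ V₁) (hW : W₂ ≤ W₁) (f : Γ(Q, V₁)) (hf : relD p h₁ f = 0) :
    relD p h₂ (res hV f) = 0 := by
  have := restrictDifferentials_d p h₁ h₂ (homOfLE hV) (homOfLE hW) f
  rw [relD_apply, relD_apply, hf, map_zero] at this
  exact this.symm

/-- A function which is a polynomial in the fibre coordinate near some point, up to functions on the
base, and whose relative differential vanishes there, is constant. -/
theorem derivative_eq_zero_of_relD (χ : LineChart q p W) {W' : P.Opens} {V : Q.Opens}
    (h : V ≤ p ⁻¹ᵁ W') (hV : V ≤ p ⁻¹ᵁ W) (y : Q) (hy : y ∈ V) (F : Polynomial Γ(P, W))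
    (hF : relD p h (res hV (Polynomial.eval₂ (p.app W).hom χ.τ F)) = 0) :
    Polynomial.derivative F = 0 := by
  have hdom := χ.isDomain
  have hdom' := χ.isDomain_preimage
  -- Shrink to principal opens `D(b)` around `p y` and `D(c)` around `y`, where all functions are
  -- fractions of functions on the chart.
  obtain ⟨b, hbW', hyb⟩ := χ.isAffineOpen.exists_basicOpen_le (V := W') ⟨p y, h hy⟩ (hV hy)
  obtain ⟨c, hcV, hyc⟩ := χ.isAffineOpen_preimage.exists_basicOpen_le
    (V := V ⊓ p ⁻¹ᵁ (P.basicOpen b)) ⟨y, hy, hyb⟩ (hV hy)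
  have hbW := P.basicOpen_le b
  have hcW := Q.basicOpen_le c
  have hcb : Q.basicOpen c ≤ p ⁻¹ᵁ (P.basicOpen b) := hcV.trans inf_le_right
  have hF' := relD_restrict h hcb (hcV.trans inf_le_left) hbW' _ hF
  rw [res_res] at hF'
  let : Algebra Γ(P, W) Γ(Q, p ⁻¹ᵁ W) := (p.app W).hom.toAlgebra
  let : Algebra Γ(P, W) Γ(Q, Q.basicOpen c) := ((res hcW).comp (p.app W).hom).toAlgebra
  have : IsScalarTower Γ(P, W) Γ(Q, p ⁻¹ᵁ W) Γ(Q, Q.basicOpen c) := .of_algebraMap_eq' rfl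
  have := χ.isAffineOpen_preimage.isLocalization_basicOpen c
  obtain ⟨δ, hδ⟩ := exists_derivation_localization (T := Γ(Q, Q.basicOpen c)) (Submonoid.powers c)
    (polyDerivation (B := Γ(P, W)) χ.τ χ.bijective)
  -- `δ` extends `d/dτ` and kills functions on `W`. Since `bⁿ a` is one of them and `b` is
  -- invertible, `δ` kills `a` as well, and so factors through the relative differentials over
  -- `D(b)`.
  have hδ0 (a : Γ(P, P.basicOpen b)) : δ (p.appLE _ _ hcb a) = 0 := by
    obtain ⟨n, x, hx⟩ := exists_pow_mul_res_eq χ.isAffineOpen b rfl hbW a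
    have hx' (z : Γ(P, W)) : δ (p.appLE _ _ hcb (res hbW z)) = 0 := by
      rw [← res_appLE (le_refl (p ⁻¹ᵁ W)) hcW hbW hcb z, ← Scheme.Hom.app_eq_appLE]
      exact δ.map_algebraMap z
    have h1 := hx' x
    rw [← hx, map_mul, δ.leibniz, ← map_pow (res hbW), hx', smul_zero, add_zero, smul_eq_mul, map_pow (res hbW)] at h1
    exact ((((isUnit_res b rfl hbW).pow n).map (p.appLE _ _ hcb).hom).mul_right_eq_zero).mp h1
  let D : (ModuleCat.of Γ(Q, Q.basicOpen c) Γ(Q, Q.basicOpen c)).Derivation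
      (p.appLE _ _ hcb) :=
    ModuleCat.Derivation.mk (fun f => δ f) (map_add δ) (fun f g => δ.leibniz f g) hδ0
  have h2 := D.desc_d (res hcW (Polynomial.eval₂ (p.app W).hom χ.τ F))
  rw [relD_apply, hF', map_zero] at h2
  have h3 : algebraMap Γ(Q, p ⁻¹ᵁ W) Γ(Q, Q.basicOpen c)
      (Polynomial.aeval χ.τ (Polynomial.derivative F)) = 0 := by
    rw [← polyDerivation_aeval χ.τ χ.bijective, ← hδ]
    exact h2.symm
  obtain ⟨n, hn⟩ := exists_pow_mul_eq_zero χ.isAffineOpen_preimage c rfl hcW _ h3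
  have hc : c ≠ 0 := by
    rintro rfl
    rw [Scheme.basicOpen_zero] at hyc
    exact hyc
  have h4 := (mul_eq_zero.mp hn).resolve_left (pow_ne_zero n hc)
  exact χ.bijective.injective (h4.trans (map_zero _).symm)

/-- Functions that are locally constant along the fibres come from the base. -/
theorem exists_app_eq_of_relD (χ : LineChart q p W) {U : P.Opens} (hU : U ≤ W)
    (f : Γ(Q, p ⁻¹ᵁ U))
    (hf : ∀ y ∈ p ⁻¹ᵁ U, ∃ (W' : P.Opens) (V : Q.Opens) (h : V ≤ p ⁻¹ᵁ W') (i : V ≤ p ⁻¹ᵁ U),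
      y ∈ V ∧ relD p h (res i f) = 0) : ∃ g, p.app U g = f := by
  have hdom := χ.isDomain
  have hdom' := χ.isDomain_preimage
  have hloc : ∀ x : U, ∃ (U' : P.Opens) (i : U' ≤ U) (g : Γ(P, U')), x.1 ∈ U' ∧
      p.app U' g = res (p.preimage_mono i) f := by
    intro x
    obtain ⟨b, hbU, hxb⟩ := χ.isAffineOpen.exists_basicOpen_le x (hU x.2)
    have hbW := P.basicOpen_le b
    have hpb := p.preimage_basicOpen b
    obtain ⟨n, s, hs⟩ := exists_pow_mul_res_eq χ.isAffineOpen_preimage (p.app W b) hpb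
      (p.preimage_mono hbW) (res (p.preimage_mono hbU) f)
    obtain ⟨F, rfl⟩ := χ.bijective.surjective s
    have hb : b ≠ 0 := by
      rintro rfl
      rw [Scheme.basicOpen_zero] at hxb
      exact hxb
    -- If `D(b)` had empty preimage, the pullback of `b` would be nilpotent, hence zero in a domain,
    -- and then `b = 0`.
    obtain ⟨y, hy⟩ : ∃ y, y ∈ p ⁻¹ᵁ (P.basicOpen b) := by
      by_contra! hne
      have : Q.basicOpen (p.app W b) = ⊥ := by
        rw [← hpb]
        ext y
        simpa using hne y
      rw [← Scheme.isNilpotent_iff_basicOpen_eq_bot_of_isCompact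
        χ.isAffineOpen_preimage.isCompact] at this
      exact hb (χ.app_injective (this.eq_zero.trans (map_zero _).symm))
    -- Vanishing of the differential near the single point `y` suffices, since the functions on the
    -- chart form a domain. Passing from `f` to `bⁿ f` is harmless because `b` comes from the base.
    have hF : Polynomial.derivative F = 0 := by
      obtain ⟨W', V, h, i, hyV, h0⟩ := hf y (p.preimage_mono hbU hy)
      have h1 : V ⊓ p ⁻¹ᵁ (P.basicOpen b) ≤ p ⁻¹ᵁ (W' ⊓ P.basicOpen b) := inf_le_inf_right _ h
      refine χ.derivative_eq_zero_of_relD h1 (inf_le_right.trans (p.preimage_mono hbW)) y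
        ⟨hyV, hy⟩ F ?_
      have h2 := relD_restrict h h1 inf_le_left inf_le_left _ h0
      have h3 := congrArg (res (inf_le_right : V ⊓ p ⁻¹ᵁ (P.basicOpen b) ≤ _)) hs
      rw [map_mul, map_pow, res_res, res_res, res_res, Polynomial.coe_eval₂RingHom] at h3
      rw [← h3, Scheme.Hom.app_eq_appLE, res_appLE (le_refl (p ⁻¹ᵁ W)) _
        (inf_le_right.trans hbW : W' ⊓ P.basicOpen b ≤ W) h1 b, ← map_pow, relD_mul, relD_appLE,
        smul_zero, add_zero]
      rw [res_res] at h2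
      rw [h2, smul_zero]
    have htf : IsAddTorsionFree Γ(P, W) := by
      have : CharZero Γ(P, W) := charZero_of_inj_zero fun n hn => by
        by_contra h0
        obtain ⟨k, rfl⟩ := Nat.exists_eq_succ_of_ne_zero h0
        exact (χ.isUnit_natCast k).ne_zero hn
      infer_instance
    rw [Polynomial.eq_C_of_derivative_eq_zero hF] at hs
    obtain ⟨u, hu⟩ := isUnit_res b rfl hbW
    refine ⟨P.basicOpen b, hbU, ↑(u⁻¹ ^ n) * res hbW (F.coeff 0), hxb, ?_⟩
    have h1 : IsUnit (p.app _ (res hbW b) ^ n) := ((isUnit_res b rfl hbW).map (p.app _).hom).pow n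
    refine h1.mul_left_cancel ?_
    rw [← map_pow, ← map_mul, ← mul_assoc, ← hu, ← Units.val_pow_eq_pow_val, ← Units.val_mul,
      ← mul_pow, mul_inv_cancel, one_pow, Units.val_one, one_mul, Units.val_pow_eq_pow_val, hu,
      map_pow, app_res hbW, app_res hbW, hs]
    simp
  choose U' i g hx hg using hloc
  -- The local functions on the base agree on overlaps because their pullbacks are restrictions of
  -- the same `f` and pullback is injective.
  have hcomp (x y : U) (T : P.Opens) (hTx : T ≤ U' x) (hTy : T ≤ U' y) :
      res hTx (g x) = res hTy (g y) := by
    refine χ.app_injective_of_le (hTx.trans ((i x).trans hU)) ?_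
    rw [app_res hTx, app_res hTy, hg, hg, res_res, res_res]
  have hcover : U ≤ iSup U' := fun x hxU =>
    TopologicalSpace.Opens.mem_iSup.mpr ⟨⟨x, hxU⟩, hx ⟨x, hxU⟩⟩
  obtain ⟨g₀, hg₀, -⟩ := TopCat.Sheaf.existsUnique_gluing' P.sheaf U' U (fun x => homOfLE (i x))
    hcover g (fun x y => hcomp x y _ inf_le_left inf_le_right)
  refine ⟨g₀, eq_of_locally_eq _ _ fun y hy => ?_⟩
  refine ⟨p ⁻¹ᵁ (U' ⟨p y, hy⟩), p.preimage_mono (i _), hx ⟨p y, hy⟩, ?_⟩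
  exact (app_res (i _) g₀).symm.trans ((congrArg (p.app _) (hg₀ _)).trans (hg _))

end LineChart

/-! ### The frame of horizontal sections -/

namespace LineChart

section FrameSection

variable {Q P : Scheme.{0}} {q : Q ⟶ Plane} {p : Q ⟶ P} {W : P.Opens}
  {M : Type} [AddCommGroup M] [Module PlaneRing M] {ι : Type} [Fintype ι]
  (b : Module.Basis ι PlaneRing M)

/-- The `j`-th horizontal section over the chart. -/
def frameSection (G : Matrix ι ι Γ(Q, p ⁻¹ᵁ W)) (j : ι) {U : P.Opens} (hU : U ≤ W) :
    Γ(bundlePullback q M, p ⁻¹ᵁ U) :=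
  ∑ k, res (p.preimage_mono hU) (G k j) • pullbackSection q (p ⁻¹ᵁ U) (b k)

theorem coordSection_frameSection (G : Matrix ι ι Γ(Q, p ⁻¹ᵁ W)) (j k : ι) {U : P.Opens}
    (hU : U ≤ W) : coordSection q (b.coord k) (p ⁻¹ᵁ U) (frameSection b G j hU) =
      res (p.preimage_mono hU) (G k j) := by
  classical
  rw [frameSection, map_sum]
  simp only [map_smul, coordSection_pullbackSection, ← pullbackFunctionHom_apply,
    Module.Basis.coord_apply, b.repr_self, Finsupp.single_apply, smul_eq_mul]
  rw [Finset.sum_eq_single k (fun l _ hl => by rw [if_neg hl, map_zero, mul_zero])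
    (fun hj => (hj (Finset.mem_univ k)).elim), if_pos rfl, map_one, mul_one]

theorem map_frameSection (G : Matrix ι ι Γ(Q, p ⁻¹ᵁ W)) (j : ι) {U U' : P.Opens} (hU : U ≤ W)
    (h : U' ≤ U) : (bundlePullback q M).presheaf.map (homOfLE (p.preimage_mono h)).op
      (frameSection b G j hU) = frameSection b G j (h.trans hU) := by
  rw [frameSection, map_sum, frameSection]
  simp only [Scheme.Modules.map_smul, map_pullbackSection]
  refine Finset.sum_congr rfl fun k _ => ?_
  congr 1
  exact res_res _ _ _

end FrameSection

section Frame

variable {Q P : Scheme.{0}} {q : Q ⟶ Plane} {p : Q ⟶ P} {W : P.Opens} (χ : LineChart q p W)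
  {M : Type} [AddCommGroup M] [Module PlaneRing M] [Module ℂ M]
  [IsScalarTower ℂ PlaneRing M] (nabla : Connection M) {ι : Type} [Fintype ι] [DecidableEq ι]
  (b : Module.Basis ι PlaneRing M) {G : Matrix ι ι Γ(Q, p ⁻¹ᵁ W)}

/-- The horizontal sections over `p⁻¹ U` are the combinations of the columns of `G` with functions
on `U` as coefficients. -/
theorem isHorizontal_iff
    (hG : ∀ k l, χ.deriv (G k l) + ∑ j, χ.relMatrix nabla b k j * G j l = 0)
    (hu : IsUnit G) {U : P.Opens} (hU : U ≤ W) (s : Γ(bundlePullback q M, p ⁻¹ᵁ U)) :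
    IsHorizontal q p nabla (p ⁻¹ᵁ U) s ↔ ∃ g : ι → Γ(P, U),
      ∀ k, coordSection q (b.coord k) (p ⁻¹ᵁ U) s =
        ∑ j, res (p.preimage_mono hU) (G k j) * p.app U (g j) := by
  constructor
  · intro hs
    obtain ⟨f, hf⟩ : ∃ f : ι → Γ(Q, p ⁻¹ᵁ U), ∀ k, coordSection q (b.coord k) (p ⁻¹ᵁ U) s =
        ∑ j, res (p.preimage_mono hU) (G k j) * f j := by
      obtain ⟨⟨G', H, h1, h2⟩, rfl⟩ := hu
      refine ⟨fun j => ∑ l, res (p.preimage_mono hU) (H j l) *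
        coordSection q (b.coord l) (p ⁻¹ᵁ U) s, fun k => ?_⟩
      simp only [Finset.mul_sum, ← mul_assoc, ← map_mul]
      rw [Finset.sum_comm]
      simp only [← Finset.sum_mul, ← map_sum, ← Matrix.mul_apply, h1, Matrix.one_apply]
      rw [Finset.sum_eq_single k (fun l _ hl => by rw [if_neg hl.symm, map_zero, zero_mul])
        (fun hj => (hj (Finset.mem_univ k)).elim), if_pos rfl, map_one, one_mul]
    have hconst (j : ι) : ∃ g, p.app U g = f j := by
      refine χ.exists_app_eq_of_relD hU (f j) fun y hy => ?_
      obtain ⟨W', V, h, i, hyV, h0⟩ := hs y hy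
      -- The open `W'` witnessing horizontality need not lie in the chart, so it is cut down to `W`.
      have hV : V ≤ p ⁻¹ᵁ (W' ⊓ W) := le_inf h (i.le.trans (p.preimage_mono hU))
      refine ⟨W' ⊓ W, V, hV, i.le, hyV, ?_⟩
      have h1 := h0.restrict hV (𝟙 V) (homOfLE inf_le_left)
      rw [← CategoryTheory.comp_apply, ← Functor.map_comp, ← op_comp, Category.id_comp] at h1
      refine (χ.isHorizontalOn_iff_relD nabla b hG hu hV inf_le_right
        (i.le.trans (p.preimage_mono hU)) _ (fun j => res i.le (f j)) (fun k => ?_)).mp h1 j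
      rw [coordSection_map, hf]
      change res i.le _ = _
      rw [map_sum]
      simp only [map_mul, res_res]
    choose g hg using hconst
    exact ⟨g, fun k => by simp only [hf, hg]⟩
  · rintro ⟨g, hg⟩ y hy
    refine ⟨U, p ⁻¹ᵁ U, le_rfl, 𝟙 _, hy, ?_⟩
    have : (bundlePullback q M).presheaf.map (𝟙 (p ⁻¹ᵁ U)).op s = s :=
      ConcreteCategory.congr_hom ((bundlePullback q M).presheaf.map_id _) _
    rw [this, χ.isHorizontalOn_iff_relD nabla b hG hu le_rfl hU (p.preimage_mono hU) s _ hg]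
    intro j
    rw [Scheme.Hom.app_eq_appLE, relD_appLE]

/-- Every horizontal section has unique coefficients in the horizontal frame. -/
theorem existsUnique_coeff
    (hG : ∀ k l, χ.deriv (G k l) + ∑ j, χ.relMatrix nabla b k j * G j l = 0)
    (hu : IsUnit G) {U : P.Opens} (hU : U ≤ W) (s : Γ(bundlePullback q M, p ⁻¹ᵁ U))
    (hs : IsHorizontal q p nabla (p ⁻¹ᵁ U) s) :
    ∃! g : ι → Γ(P, U), s = ∑ j, p.app U (g j) • frameSection b G j hU := by
  have key (g : ι → Γ(P, U)) : s = ∑ j, p.app U (g j) • frameSection b G j hU ↔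
      ∀ k, coordSection q (b.coord k) (p ⁻¹ᵁ U) s =
        ∑ j, res (p.preimage_mono hU) (G k j) * p.app U (g j) := by
    have h1 (k : ι) : coordSection q (b.coord k) (p ⁻¹ᵁ U)
        (∑ j, p.app U (g j) • frameSection b G j hU) =
          ∑ j, res (p.preimage_mono hU) (G k j) * p.app U (g j) := by
      rw [map_sum]
      refine Finset.sum_congr rfl fun j _ => ?_
      rw [map_smul, coordSection_frameSection, smul_eq_mul, mul_comm]
    constructor
    · intro h k
      rw [← h1, ← h]
    · intro h
      rw [← sum_coordSection_smul q b (p ⁻¹ᵁ U) s,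
        ← sum_coordSection_smul q b (p ⁻¹ᵁ U) (∑ j, p.app U (g j) • frameSection b G j hU)]
      simp only [h, h1]
  simp only [key]
  obtain ⟨g, hg⟩ := (χ.isHorizontal_iff nabla b hG hu hU s).mp hs
  refine ⟨g, hg, fun g' hg' => ?_⟩
  obtain ⟨⟨G', H, h1, h2⟩, rfl⟩ := hu
  ext j
  refine χ.app_injective_of_le hU ?_
  have h3 (f : ι → Γ(Q, p ⁻¹ᵁ U)) : ∑ k, res (p.preimage_mono hU) (H j k) *
      ∑ l, res (p.preimage_mono hU) (G' k l) * f l = f j := by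
    simp only [Finset.mul_sum, ← mul_assoc, ← map_mul]
    rw [Finset.sum_comm]
    simp only [← Finset.sum_mul, ← map_sum, ← Matrix.mul_apply, h2, Matrix.one_apply]
    rw [Finset.sum_eq_single j (fun l _ hl => by rw [if_neg hl.symm, map_zero, zero_mul])
      (fun hj => (hj (Finset.mem_univ j)).elim), if_pos rfl, map_one, one_mul]
  rw [← h3 (fun j => p.app U (g j)), ← h3 (fun j => p.app U (g' j))]
  refine Finset.sum_congr rfl fun k _ => ?_
  rw [← hg, ← hg']

theorem isHorizontal_frameSection
    (hG : ∀ k l, χ.deriv (G k l) + ∑ j, χ.relMatrix nabla b k j * G j l = 0)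
    (hu : IsUnit G) {U : P.Opens} (hU : U ≤ W) (j : ι) :
    IsHorizontal q p nabla (p ⁻¹ᵁ U) (frameSection b G j hU) := by
  rw [χ.isHorizontal_iff nabla b hG hu hU]
  refine ⟨Pi.single j 1, fun k => ?_⟩
  rw [coordSection_frameSection, Finset.sum_eq_single j
    (fun l _ hl => by rw [Pi.single_eq_of_ne hl, map_zero, mul_zero])
    (fun hj => (hj (Finset.mem_univ j)).elim), Pi.single_eq_same, map_one, mul_one]

end Frame

end LineChart

/-! ### A criterion for freeness -/

section FreeCriterion

/-- An object which is a biproduct of copies of `u` is isomorphic to any coproduct of copies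
of `u`. -/
theorem nonempty_iso_of_isColimit {C : Type*} [Category C] [Preadditive C] {ι : Type*} [Fintype ι]
    {u F : C} (c : Limits.Cofan fun _ : ι => u) (hc : Limits.IsColimit c) (incl : ι → (u ⟶ F))
    (proj : ι → (F ⟶ u)) (h1 : ∀ j, incl j ≫ proj j = 𝟙 u)
    (h1' : ∀ j k, j ≠ k → incl j ≫ proj k = 0) (h2 : ∑ j, proj j ≫ incl j = 𝟙 F) :
    Nonempty (F ≅ c.pt) := by
  have hψ (j : ι) : c.inj j ≫ Limits.Cofan.IsColimit.desc hc incl = incl j :=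
    Limits.Cofan.IsColimit.fac hc incl j
  refine ⟨⟨∑ j, proj j ≫ c.inj j, Limits.Cofan.IsColimit.desc hc incl, ?_, ?_⟩⟩
  · simp only [Preadditive.sum_comp, Category.assoc, hψ, h2]
  · refine Limits.Cofan.IsColimit.hom_ext hc _ _ fun j => ?_
    rw [← Category.assoc, hψ, Preadditive.comp_sum, Finset.sum_eq_single j
      (fun l _ hl => by rw [← Category.assoc, h1' j l hl.symm, Limits.zero_comp])
      (fun hj => (hj (Finset.mem_univ j)).elim), ← Category.assoc, h1, Category.id_comp]
    exact (Category.comp_id _).symm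

variable {Y : Scheme.{0}} {F : Y.Modules} {ι : Type} [Fintype ι]

theorem sum_app_apply {G : Y.Modules} {κ : Type} (t : Finset κ) (φ : κ → (F ⟶ G)) (U : Y.Opens)
    (s : Γ(F, U)) : (∑ j ∈ t, φ j).app U s = ∑ j ∈ t, (φ j).app U s := by
  classical
  induction t using Finset.induction_on with
  | empty => simp
  | insert a t ha ih =>
    rw [Finset.sum_insert ha, Finset.sum_insert ha, ← ih]
    rfl

/-- A sheaf of modules with a compatible family of bases on all open sets is free. -/
theorem nonempty_iso_free (e : ∀ U : Y.Opens, ι → Γ(F, U))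
    (he : ∀ {U V : Y.Opens} (i : V ⟶ U) (j : ι), F.presheaf.map i.op (e U j) = e V j)
    (hF : ∀ (U : Y.Opens) (s : Γ(F, U)), ∃! g : ι → Γ(Y, U), s = ∑ j, g j • e U j) :
    Nonempty (F ≅ (SheafOfModules.free ι : Y.Modules)) := by
  classical
  choose g hg using fun U s => (hF U s).exists
  -- Uniqueness of coefficients is what makes them linear in `s` and compatible with restriction.
  have huniq {U : Y.Opens} {s : Γ(F, U)} {f : ι → Γ(Y, U)} (h : s = ∑ j, f j • e U j) : g U s = f :=
    (hF U s).unique (hg U s) h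
  let incl (j : ι) : unitModule Y ⟶ F := unitHomOfSection (U₀ := ⊤) (fun _ => le_top) (e ⊤ j)
  have hincl (j : ι) (U : Y.Opens) (f : Γ(Y, U)) : (incl j).app U f = f • e U j := by
    rw [← he (homOfLE (le_top : U ≤ ⊤)) j]
    exact unitHomOfSection_app _ _ U f
  let lin (j : ι) (U : Y.Opens) : Γ(F, U) →ₗ[Γ(Y, U)] Γ(Y, U) :=
    { toFun := fun s => g U s j
      map_add' := fun s t => by
        rw [huniq (f := g U s + g U t)]
        · rfl
        · conv_lhs => rw [hg U s, hg U t, ← Finset.sum_add_distrib]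
          simp only [Pi.add_apply, add_smul]
      map_smul' := fun a s => by
        rw [huniq (f := a • g U s)]
        · rfl
        · conv_lhs => rw [hg U s, Finset.smul_sum]
          simp only [Pi.smul_apply, smul_eq_mul, mul_smul] }
  have hlin (j : ι) {U V : Y.Opens} (i : V ⟶ U) (s : Γ(F, U)) :
      lin j V (F.presheaf.map i.op s) = Y.presheaf.map i.op (lin j U s) := by
    have : g V (F.presheaf.map i.op s) = fun j => Y.presheaf.map i.op (g U s j) := by
      refine huniq ?_
      conv_lhs => rw [hg U s, map_sum]
      simp only [Scheme.Modules.map_smul, he]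
    exact congrFun this j
  let proj (j : ι) : F ⟶ unitModule Y := modulesHomMk (G := unitModule Y) (lin j) (hlin j)
  have hproj (j : ι) (U : Y.Opens) (s : Γ(F, U)) : (proj j).app U s = g U s j := rfl
  have hsingle (j : ι) (U : Y.Opens) (f : Γ(Y, U)) : g U (f • e U j) = Pi.single j f := by
    refine huniq ?_
    rw [Finset.sum_eq_single j (fun l _ hl => by rw [Pi.single_eq_of_ne hl, zero_smul])
      (fun hj => (hj (Finset.mem_univ j)).elim), Pi.single_eq_same]
  have happ (j k : ι) (U : Y.Opens) (f : Γ(Y, U)) :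
      (incl j ≫ proj k).app U f = (Pi.single j f : ι → Γ(Y, U)) k :=
    (congrArg (fun s => g U s k) (hincl j U f)).trans (congrFun (hsingle j U f) k)
  have h1 (j : ι) : incl j ≫ proj j = 𝟙 _ := by
    ext U f
    exact (happ j j U f).trans (Pi.single_eq_same (M := fun _ => Γ(Y, U)) j f)
  have h1' (j k : ι) (h : j ≠ k) : incl j ≫ proj k = 0 := by
    ext U f
    exact (happ j k U f).trans (Pi.single_eq_of_ne (M := fun _ => Γ(Y, U)) h.symm f)
  have h2 : ∑ j, proj j ≫ incl j = 𝟙 F := by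
    ext U s
    refine (sum_app_apply _ _ U s).trans ?_
    refine Eq.trans ?_ (hg U s).symm
    exact Finset.sum_congr rfl fun j _ => hincl j U (g U s j)
  -- The free sheaf enters only through its universal property as a coproduct of copies of the
  -- structure sheaf.
  have key (c : Limits.Cofan fun _ : ι => unitModule Y) (hc : Limits.IsColimit c) :
      Nonempty (F ≅ c.pt) := nonempty_iso_of_isColimit c hc incl proj h1 h1' h2
  exact key _ (SheafOfModules.isColimitFreeCofan (R := Y.ringCatSheaf) ι)

end FreeCriterion

/-! ### Freeness over a chart -/

namespace LineChart

variable {Q P : Scheme.{0}} {q : Q ⟶ Plane} {p : Q ⟶ P} {W : P.Opens}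
  {M : Type} [AddCommGroup M] [Module PlaneRing M] [Module ℂ M]
  [IsScalarTower ℂ PlaneRing M]

/-- Over a chart the sheaf of horizontal sections is free. -/
theorem nonempty_restrict_iso_free (χ : LineChart q p W) (nabla : Connection M) {ι : Type}
    [Fintype ι] (b : Module.Basis ι PlaneRing M) (w : ι → ℤ)
    (hw : ∀ i k l, nabla.matrix b i k l ≠ 0 → w k < w l) :
    Nonempty ((horizontalSheaf q p nabla).restrict W.ι ≅
      (SheafOfModules.free ι : W.toScheme.Modules)) := by
  classical
  obtain ⟨G, hu, hG⟩ := χ.exists_gauge nabla b w hw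
  have hle (U : W.toScheme.Opens) : W.ι ''ᵁ U ≤ W := W.ι_image_le U
  refine nonempty_iso_free
    (fun U j => ⟨frameSection b G j (hle U), χ.isHorizontal_frameSection nabla b hG hu (hle U) j⟩)
    (fun {U V} i j => Subtype.ext (map_frameSection b G j (hle U)
      (W.ι.image_mono i.le))) fun U s => ?_
  obtain ⟨g, hg, huniq⟩ := χ.existsUnique_coeff nabla b hG hu (hle U) s.1 s.2
  let val : Γ((horizontalSheaf q p nabla).restrict W.ι, U) →+
      Γ(bundlePullback q M, p ⁻¹ᵁ (W.ι ''ᵁ U)) :=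
    { toFun := fun t => t.1
      map_zero' := rfl
      map_add' := fun _ _ => rfl }
  have hval : Function.Injective val := fun _ _ h => Subtype.ext h
  -- Scalars on the open subscheme act through `appIso`, which is the identity for the inclusion of
  -- an open.
  have hsmul (a : Γ(W.toScheme, U)) (t : Γ((horizontalSheaf q p nabla).restrict W.ι, U)) :
      val (a • t) = p.app (W.ι ''ᵁ U) a • val t := by
    have h1 : val (a • t) = p.app (W.ι ''ᵁ U) ((W.ι.appIso U).inv a) • val t := rfl
    rw [h1, Scheme.Opens.ι_appIso]
    rfl
  have key (g : ι → Γ(W.toScheme, U)) : s = ∑ j, g j •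
      (show Γ((horizontalSheaf q p nabla).restrict W.ι, U) from ⟨frameSection b G j (hle U),
        χ.isHorizontal_frameSection nabla b hG hu (hle U) j⟩) ↔
      s.1 = ∑ j, p.app (W.ι ''ᵁ U) (g j) • frameSection b G j (hle U) := by
    rw [← hval.eq_iff, map_sum]
    have h2 := Finset.sum_congr rfl fun j (_ : j ∈ Finset.univ) => hsmul (g j)
      ⟨frameSection b G j (hle U), χ.isHorizontal_frameSection nabla b hG hu (hle U) j⟩
    exact ⟨fun h => h.trans h2, fun h => h.trans h2.symm⟩
  exact ⟨g, (key g).mpr hg, fun g' hg' => huniq g' ((key g').mp hg')⟩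

end LineChart

/-! ### Fractions of degree zero -/

section Dehomogenization

open HomogeneousLocalization

variable {σ R T : Type} [CommRing R] [CommRing T]

/-- The constants in the degree zero part of `R[σ]_f`. -/
def awayC (f : MvPolynomial σ R) : R →+* Away (homogeneousSubmodule σ R) f :=
  (fromZeroRingHom (homogeneousSubmodule σ R) (Submonoid.powers f)).comp
    (algebraMap R (homogeneousSubmodule σ R 0))

/-- The fraction `Xᵢ / f`, for `f` of degree one. -/
def awayX {f : MvPolynomial σ R} (hf : f ∈ homogeneousSubmodule σ R 1) (i : σ) :
    Away (homogeneousSubmodule σ R) f :=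
  Away.mk _ hf 1 (X i) (by simpa using isHomogeneous_X R i)

theorem val_awayC (f : MvPolynomial σ R) (r : R) :
    (awayC f r).val = algebraMap (MvPolynomial σ R) (Localization.Away f) (C r) := by
  rw [← Localization.mk_one_eq_algebraMap]
  rfl

theorem val_awayX {f : MvPolynomial σ R} (hf : f ∈ homogeneousSubmodule σ R 1) (i : σ) :
    (awayX hf i).val = algebraMap (MvPolynomial σ R) (Localization.Away f) (X i) *
      IsLocalization.Away.invSelf f := by
  rw [awayX, Away.val_mk, Localization.mk_eq_mk', IsLocalization.mk'_eq_mul_mk'_one,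
    IsLocalization.Away.invSelf]
  simp only [pow_one]

/-- Every monomial of `x` has exactly `n` factors, so the `n` denominators `f` can be distributed
one to each variable. Hence the constants and the `Xᵢ / f` generate the ring. -/
theorem away_mk_eq_eval₂ {f : MvPolynomial σ R} (hf : f ∈ homogeneousSubmodule σ R 1) (n : ℕ)
    (x : MvPolynomial σ R) (hx : x ∈ homogeneousSubmodule σ R (n • 1)) :
    Away.mk _ hf n x hx = eval₂ (awayC f) (awayX hf) x := by
  apply val_injective
  have hinv : algebraMap (MvPolynomial σ R) (Localization.Away f) f * IsLocalization.Away.invSelf f = 1 :=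
    IsLocalization.Away.mul_invSelf f
  have h1 : (Away.mk _ hf n x hx).val =
      algebraMap (MvPolynomial σ R) (Localization.Away f) x * IsLocalization.Away.invSelf f ^ n := by
    rw [Away.val_mk, Localization.mk_eq_mk', IsLocalization.mk'_eq_iff_eq_mul, map_pow]
    rw [mul_assoc, ← mul_pow, mul_comm (IsLocalization.Away.invSelf f), hinv, one_pow, mul_one]
  rw [h1, ← HomogeneousLocalization.algebraMap_apply, eval₂_eq, map_sum]
  conv_lhs => rw [x.as_sum, map_sum, Finset.sum_mul]
  refine Finset.sum_congr rfl fun m hm => ?_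
  have hd : m.degree = n := by
    have := (show x.IsHomogeneous (n • 1) from hx) (mem_support_iff.mp hm)
    rw [Finsupp.degree_eq_weight_one]
    exact this.trans (by simp)
  rw [map_mul, map_prod, HomogeneousLocalization.algebraMap_apply, val_awayC]
  simp only [map_pow, HomogeneousLocalization.algebraMap_apply, val_awayX, mul_pow, Finset.prod_mul_distrib]
  rw [Finset.prod_pow_eq_pow_sum, ← Finsupp.degree_apply, hd, monomial_eq, Finsupp.prod, map_mul,
    map_prod]
  simp only [map_pow, mul_assoc]

theorem away_ringHom_ext {f : MvPolynomial σ R} (hf : f ∈ homogeneousSubmodule σ R 1)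
    {g h : Away (homogeneousSubmodule σ R) f →+* T}
    (hC : ∀ r, g (awayC f r) = h (awayC f r)) (hX : ∀ i, g (awayX hf i) = h (awayX hf i)) :
    g = h := by
  ext y
  obtain ⟨n, x, hx, rfl⟩ := Away.mk_surjective _ hf y
  rw [away_mk_eq_eval₂, hom_eval₂, hom_eval₂, RingHom.ext hC (f := g.comp _) (g := h.comp _)]
  congr 1
  exact funext hX

/-- Evaluation of fractions of degree zero under a homomorphism that sends the denominator
to `1`. -/
def awayEval (f : MvPolynomial σ R) (g : MvPolynomial σ R →+* T) (hg : g f = 1) :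
    Away (homogeneousSubmodule σ R) f →+* T :=
  (IsLocalization.Away.lift (S := Localization.Away f) f (g := g)
    (hg ▸ isUnit_one)).comp (algebraMap _ (Localization.Away f))

theorem awayEval_awayC (f : MvPolynomial σ R) (g : MvPolynomial σ R →+* T) (hg : g f = 1) (r : R) :
    awayEval f g hg (awayC f r) = g (C r) := by
  rw [awayEval, RingHom.comp_apply, HomogeneousLocalization.algebraMap_apply, val_awayC, IsLocalization.Away.lift_eq]

theorem awayEval_awayX {f : MvPolynomial σ R} (hf : f ∈ homogeneousSubmodule σ R 1)
    (g : MvPolynomial σ R →+* T) (hg : g f = 1) (i : σ) :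
    awayEval f g hg (awayX hf i) = g (X i) := by
  have key (L : Localization.Away f →+* T) (hL : L (algebraMap (MvPolynomial σ R) _ f) = 1) :
      L (IsLocalization.Away.invSelf f) = 1 := by
    have h := congrArg L (IsLocalization.Away.mul_invSelf (S := Localization.Away f) f)
    rwa [map_mul, hL, one_mul, map_one] at h
  rw [awayEval, RingHom.comp_apply, HomogeneousLocalization.algebraMap_apply, val_awayX, map_mul,
    IsLocalization.Away.lift_eq, key _ (by rw [IsLocalization.Away.lift_eq, hg]), mul_one]

end Dehomogenization

/-! ### Coordinate rings of the two charts -/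

section LineRing

open HomogeneousLocalization

/-- The coordinate ring of the variety of lines with `v_{a+1} ≠ 0`. -/
abbrev LineRing (a : Fin 2) : Type := Away dualGrading (X a.succ : MvPolynomial (Fin 3) ℂ)

/-- The coordinate ring of the incidence variety over the lines with `v_{a+1} ≠ 0`. -/
abbrev FlagRing (a : Fin 2) : Type := Away incidenceGrading (lineHom (X a.succ))

/-- The pullback of functions from the variety of lines to the incidence variety. -/
abbrev flagHom (a : Fin 2) : LineRing a →+* FlagRing a := Away.map lineHom (X a.succ)

theorem X_mem_dualGrading (i : Fin 3) : (X i : MvPolynomial (Fin 3) ℂ) ∈ dualGrading 1 :=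
  isHomogeneous_X ℂ i

theorem lineHom_X_mem (i : Fin 3) : lineHom (X i) ∈ incidenceGrading 1 :=
  GradedFunLike.map_mem lineHom (X_mem_dualGrading i)

theorem lineHom_X_succ (a : Fin 2) : lineHom (X a.succ) = X a := by
  fin_cases a
  · exact lineHom_X_one
  · exact lineHom_X_two

theorem lineHom_X_zero (a : Fin 2) :
    lineHom (X 0) = -(C (X a) * X a + C (X a.rev) * X a.rev) := by
  refine (aeval_X (R := ℂ) lineCoord 0).trans ?_
  fin_cases a
  · rfl
  · simp [lineCoord, add_comm]

instance (a : Fin 2) : IsDomain (LineRing a) := by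
  have : IsDomain (Localization.Away (X a.succ : MvPolynomial (Fin 3) ℂ)) :=
    IsLocalization.isDomain_localization (powers_le_nonZeroDivisors_of_noZeroDivisors (X_ne_zero _))
  exact (val_injective (𝒜 := dualGrading) (x := .powers (X a.succ))).isDomain
    (algebraMap (LineRing a) (Localization.Away (X a.succ : MvPolynomial (Fin 3) ℂ)))

theorem flagHom_awayX (a : Fin 2) (i : Fin 3) :
    flagHom a (awayX (X_mem_dualGrading _) i) =
      eval₂ (awayC _) (awayX (lineHom_X_mem a.succ)) (lineHom (X i)) :=
  (Away.map_mk lineHom _ (X_mem_dualGrading _) 1 (X i) _).trans (away_mk_eq_eval₂ _ _ _ _)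

theorem flagHom_awayC (a : Fin 2) (c : ℂ) :
    flagHom a (awayC _ c) = awayC (lineHom (X a.succ)) (C c) := by
  refine (HomogeneousLocalization.map_mk _ _ _).trans ?_
  apply val_injective
  rw [val_mk, val_awayC, ← Localization.mk_one_eq_algebraMap]
  congr 1
  · exact aeval_C (R := ℂ) lineCoord c
  · exact Subtype.ext (map_one lineHom)

theorem awayX_self (a : Fin 2) : awayX (lineHom_X_mem a.succ) a = 1 := by
  apply val_injective
  rw [val_awayX, val_one]
  conv_lhs => enter [1, 2]; rw [← lineHom_X_succ]
  exact IsLocalization.Away.mul_invSelf _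

theorem flagHom_awayX_succ (a b : Fin 2) :
    flagHom a (awayX (X_mem_dualGrading _) b.succ) = awayX (lineHom_X_mem a.succ) b := by
  rw [flagHom_awayX]
  conv_lhs => enter [3]; rw [lineHom_X_succ]
  exact eval₂_X _ _ _

theorem flagHom_awayX_zero (a : Fin 2) :
    flagHom a (awayX (X_mem_dualGrading _) 0) =
      -(awayC _ (X a) + awayC _ (X a.rev) * awayX (lineHom_X_mem a.succ) a.rev) := by
  rw [flagHom_awayX, lineHom_X_zero a]
  simp only [eval₂_neg, eval₂_add, eval₂_mul, eval₂_C, eval₂_X, awayX_self, mul_one]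

/-- The equation of the line, divided by its invertible coefficient and solved for the corresponding
coordinate; this provides `intercept` and `slope`. -/
theorem awayC_X (a : Fin 2) : awayC (lineHom (X a.succ)) (X a) =
    flagHom a (-awayX (X_mem_dualGrading _) 0) +
      flagHom a (-awayX (X_mem_dualGrading _) a.rev.succ) * awayC (lineHom (X a.succ)) (X a.rev) := by
  rw [map_neg, map_neg, flagHom_awayX_zero, flagHom_awayX_succ]
  ring

/-- The inverse of evaluation of polynomials over `LineRing a` at the other affine coordinate. -/
def flagEvalInv (a : Fin 2) : FlagRing a →+* Polynomial (LineRing a) :=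
  -- The free affine coordinate goes to the polynomial variable and the other one to intercept plus
  -- slope times it; the homogeneous coordinate in the denominator goes to `1`.
  awayEval _ (eval₂Hom (eval₂Hom (Polynomial.C.comp (awayC _))
      (Function.update (fun _ => Polynomial.X) a
        (Polynomial.C (-awayX (X_mem_dualGrading _) 0) +
          Polynomial.C (-awayX (X_mem_dualGrading _) a.rev.succ) * Polynomial.X)))
    (Function.update (fun b => Polynomial.C (awayX (X_mem_dualGrading a.succ) b.succ)) a 1))
    (by rw [lineHom_X_succ]; simp)

/-- The incidence variety over the lines with `v_{a+1} ≠ 0` is a trivial line bundle, with the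
other affine coordinate as coordinate on the fibres. -/
theorem bijective_flagEval (a : Fin 2) : Function.Bijective
    (Polynomial.eval₂RingHom (flagHom a) (awayC (lineHom (X a.succ)) (X a.rev))) := by
  have hne : a.rev ≠ a := by fin_cases a <;> decide
  have hrev (b : Fin 2) (hb : b ≠ a) : b = a.rev := by
    revert hb; fin_cases a <;> fin_cases b <;> decide
  have hself : (awayX (X_mem_dualGrading a.succ) a.succ) = 1 := by
    apply val_injective
    rw [val_awayX, IsLocalization.Away.mul_invSelf, val_one]
  have hC (c : ℂ) : flagEvalInv a (awayC _ (C c)) = Polynomial.C (awayC _ c) := by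
    rw [flagEvalInv, awayEval_awayC]; simp
  have ht : flagEvalInv a (awayC _ (X a.rev)) = Polynomial.X := by
    rw [flagEvalInv, awayEval_awayC]; simp [hne]
  have hta : flagEvalInv a (awayC _ (X a)) = 
      Polynomial.C (-awayX (X_mem_dualGrading _) 0) +
          Polynomial.C (-awayX (X_mem_dualGrading _) a.rev.succ) * Polynomial.X := by
    rw [flagEvalInv, awayEval_awayC]; simp
  have hX (b : Fin 2) : flagEvalInv a (awayX (lineHom_X_mem a.succ) b) =
      Polynomial.C (awayX (X_mem_dualGrading a.succ) b.succ) := by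
    rw [flagEvalInv, awayEval_awayX]
    by_cases hb : b = a
    · subst hb; simp [hself]
    · simp [hb]
  have h1 : (flagEvalInv a).comp (Polynomial.eval₂RingHom (flagHom a)
      (awayC (lineHom (X a.succ)) (X a.rev))) = RingHom.id _ := by
    apply Polynomial.ringHom_ext'
    · apply away_ringHom_ext (X_mem_dualGrading _)
      · intro c
        simp [flagHom_awayC, hC]
      · intro i
        simp only [RingHom.comp_apply, RingHom.id_apply, Polynomial.coe_eval₂RingHom,
          Polynomial.eval₂_C]
        refine Fin.cases ?_ (fun b => ?_) i
        -- The image of `v₀` is found by applying `flagEvalInv` to the incidence equation and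
        -- solving for it.
        · have h := congrArg (flagEvalInv a) (eq_neg_iff_add_eq_zero.mp (flagHom_awayX_zero a))
          simp only [map_add, map_mul, map_zero, hta, ht, hX, map_neg] at h
          linear_combination h
        · rw [flagHom_awayX_succ, hX]
    · simp [ht]
  have h2 : (Polynomial.eval₂RingHom (flagHom a)
      (awayC (lineHom (X a.succ)) (X a.rev))).comp (flagEvalInv a) = RingHom.id _ := by
    apply away_ringHom_ext (lineHom_X_mem _)
    · suffices h : ((Polynomial.eval₂RingHom (flagHom a)
          (awayC (lineHom (X a.succ)) (X a.rev))).comp (flagEvalInv a)).comp (awayC _) = awayC _ from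
        RingHom.congr_fun h
      apply MvPolynomial.ringHom_ext
      · intro c
        simp [hC, flagHom_awayC]
      · intro b
        by_cases hb : b = a
        · subst hb
          rw [RingHom.comp_apply, RingHom.comp_apply, hta, awayC_X]
          simp only [map_add, map_mul, Polynomial.coe_eval₂RingHom, Polynomial.eval₂_C,
            Polynomial.eval₂_X]
        · obtain rfl := hrev b hb
          simp [ht]
    · intro b
      simp [hX, flagHom_awayX_succ]
  exact Function.bijective_iff_has_inverse.mpr
    ⟨flagEvalInv a, RingHom.congr_fun h1, RingHom.congr_fun h2⟩

end LineRing

/-! ### From coordinate rings to charts of the punctured dual plane -/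

open HomogeneousLocalization in
/-- Functions of degree zero on `D₊(f)`. -/
theorem toSpecZero_appLE {σ A : Type} [CommRing A] [SetLike σ A] [AddSubgroupClass σ A] (𝒜 : ℕ → σ)
    [GradedRing 𝒜] (f : A) {m : ℕ} (hf : f ∈ 𝒜 m) (hm : 0 < m) :
    (Scheme.ΓSpecIso (.of (𝒜 0))).inv ≫
        (Proj.toSpecZero 𝒜).appLE ⊤ (Proj.basicOpen 𝒜 f) (le_preimage_top _ _) =
      CommRingCat.ofHom (fromZeroRingHom 𝒜 (Submonoid.powers f)) ≫ Proj.awayToSection 𝒜 f := by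
  have h : (Proj.basicOpen 𝒜 f).ι ≫ Proj.toSpecZero 𝒜 =
      Proj.basicOpenToSpec 𝒜 f ≫ Spec.map (CommRingCat.ofHom (fromZeroRingHom 𝒜 _)) := by
    rw [← Proj.awayι_toSpecZero 𝒜 f hf hm, Proj.awayι, ← Proj.basicOpenIsoSpec_hom 𝒜 f hf hm,
      Category.assoc, Iso.hom_inv_id_assoc]
  have h2 : (Proj.toSpecZero 𝒜).appLE ⊤ (Proj.basicOpen 𝒜 f) (le_preimage_top _ _) ≫
      (Proj.basicOpen 𝒜 f).topIso.inv =
      ((Proj.basicOpen 𝒜 f).ι ≫ Proj.toSpecZero 𝒜).appTop := by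
    simp [Scheme.Hom.appLE]
    rfl
  have h3 : (Proj.basicOpenToSpec 𝒜 f).appTop = (Scheme.ΓSpecIso _).hom ≫
      Proj.awayToSection 𝒜 f ≫ (Proj.basicOpen 𝒜 f).topIso.inv := Proj.basicOpenToSpec_app_top 𝒜 f
  rw [← cancel_mono (Proj.basicOpen 𝒜 f).topIso.inv, Category.assoc, h2, h, Scheme.Hom.comp_appTop,
    h3, ← Scheme.ΓSpecIso_inv_naturality_assoc, Iso.inv_hom_id_assoc, Category.assoc]

theorem pullbackFunction_basicOpen (f : MvPolynomial (Fin 2) PlaneRing)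
    (hf : f ∈ incidenceGrading 1) (x : PlaneRing) :
    pullbackFunction q₀ (Proj.basicOpen incidenceGrading f) x =
      Proj.awayToSection incidenceGrading f (awayC f x) := by
  have h : (Scheme.ΓSpecIso (.of PlaneRing)).inv ≫ q₀.appLE ⊤ (Proj.basicOpen incidenceGrading f)
      (le_preimage_top _ _) = CommRingCat.ofHom (awayC f) ≫ Proj.awayToSection incidenceGrading f := by
    rw [awayC, CommRingCat.ofHom_comp, Category.assoc, ← toSpecZero_appLE incidenceGrading f hf one_pos]
    simp only [q₀]
    rw [Scheme.Hom.comp_appLE]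
    exact (Scheme.ΓSpecIso_inv_naturality_assoc _ _).symm
  exact RingHom.congr_fun (congrArg CommRingCat.Hom.hom h) x

/-- The lines with `v_{a+1} ≠ 0`. -/
abbrev lineOpen (a : Fin 2) : PuncturedDualPlane.Opens :=
  puncturedOpen.ι ⁻¹ᵁ Proj.basicOpen dualGrading (X a.succ)

theorem basicOpen_le_puncturedOpen (a : Fin 2) :
    Proj.basicOpen dualGrading (X a.succ) ≤ puncturedOpen := by
  fin_cases a
  · exact le_sup_left
  · exact le_sup_right

theorem exists_mem_lineOpen (x : PuncturedDualPlane) : ∃ a, x ∈ lineOpen a :=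
  x.2.elim (fun h => ⟨0, h⟩) (fun h => ⟨1, h⟩)

theorem p₀_ι : p₀ ≫ puncturedOpen.ι = incidenceToDual :=
  IsOpenImmersion.lift_fac _ _ _

theorem p₀_preimage_lineOpen (a : Fin 2) :
    p₀ ⁻¹ᵁ lineOpen a = Proj.basicOpen incidenceGrading (lineHom (X a.succ)) := by
  change (p₀ ≫ puncturedOpen.ι) ⁻¹ᵁ Proj.basicOpen dualGrading (X a.succ) = _
  rw [p₀_ι]
  rfl

theorem isAffineOpen_lineOpen (a : Fin 2) : IsAffineOpen (lineOpen a) :=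
  (Proj.isAffineOpen_basicOpen dualGrading _ (X_mem_dualGrading _) one_pos).preimage_of_isOpenImmersion
    _ (by rw [Scheme.Opens.opensRange_ι]; exact basicOpen_le_puncturedOpen a)

theorem isAffineOpen_preimage_lineOpen (a : Fin 2) : IsAffineOpen (p₀ ⁻¹ᵁ lineOpen a) := by
  rw [p₀_preimage_lineOpen]
  exact Proj.isAffineOpen_basicOpen incidenceGrading _ (lineHom_X_mem _) one_pos

/-- Functions on the lines with `v_{a+1} ≠ 0`. -/
def lineRingHom (a : Fin 2) : CommRingCat.of (LineRing a) ⟶ Γ(PuncturedDualPlane, lineOpen a) :=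
  Proj.awayToSection dualGrading (X a.succ) ≫ puncturedOpen.ι.app _

instance (a : Fin 2) : IsIso (lineRingHom a) := by
  have h1 : IsIso (Proj.awayToSection dualGrading (X a.succ)) := by
    rw [← Proj.basicOpenIsoAway_hom dualGrading _ (X_mem_dualGrading _) one_pos]
    infer_instance
  have h2 : IsIso (puncturedOpen.ι.app (Proj.basicOpen dualGrading (X a.succ))) :=
    Scheme.Hom.isIso_app _ _ (by rw [Scheme.Opens.opensRange_ι]; exact basicOpen_le_puncturedOpen a)
  exact IsIso.comp_isIso' h1 h2

/-- Functions on the incidence variety over the lines with `v_{a+1} ≠ 0`. -/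
def flagRingHom (a : Fin 2) : CommRingCat.of (FlagRing a) ⟶ Γ(Incidence, p₀ ⁻¹ᵁ lineOpen a) :=
  Proj.awayToSection incidenceGrading (lineHom (X a.succ)) ≫
    Incidence.presheaf.map (eqToHom (p₀_preimage_lineOpen a)).op

instance (a : Fin 2) : IsIso (flagRingHom a) := by
  have h1 : IsIso (Proj.awayToSection incidenceGrading (lineHom (X a.succ))) := by
    rw [← Proj.basicOpenIsoAway_hom incidenceGrading _ (lineHom_X_mem _) one_pos]
    infer_instance
  exact IsIso.comp_isIso' h1 inferInstance

/-- Identifies pullback along `p₀` with `flagHom`, so that `bijective_flagEval` transfers to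
functions on the schemes. -/
theorem lineRingHom_app (a : Fin 2) :
    lineRingHom a ≫ p₀.app (lineOpen a) = CommRingCat.ofHom (flagHom a) ≫ flagRingHom a := by
  rw [lineRingHom, flagRingHom, Category.assoc]
  have h : puncturedOpen.ι.app (Proj.basicOpen dualGrading (X a.succ)) ≫ p₀.app (lineOpen a) =
      incidenceToDual.appLE (Proj.basicOpen dualGrading (X a.succ)) _
        (p₀_preimage_lineOpen a).le := by
    have := Scheme.Hom.comp_appLE p₀ puncturedOpen.ι (Proj.basicOpen dualGrading (X a.succ)) _
      (le_refl (p₀ ⁻¹ᵁ lineOpen a))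
    rw [Scheme.Hom.app_eq_appLE (f := p₀)]
    refine this.symm.trans ?_
    simp only [p₀_ι]
  rw [h, ← reassoc_of% (Proj.awayToSection_comp_appLE lineHom irrelevant_le_map_lineHom
    (X_mem_dualGrading a.succ))]
  exact congrArg _ (Scheme.Hom.appLE_map _ _ _).symm

theorem pullbackFunction_flagRingHom (a : Fin 2) (x : PlaneRing) :
    pullbackFunction q₀ (p₀ ⁻¹ᵁ lineOpen a) x = flagRingHom a (awayC _ x) := by
  rw [flagRingHom, CategoryTheory.comp_apply, ← pullbackFunction_basicOpen _ (lineHom_X_mem _),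
    map_pullbackFunction]

theorem app_lineRingHom (a : Fin 2) (y : LineRing a) :
    p₀.app (lineOpen a) (lineRingHom a y) = flagRingHom a (flagHom a y) :=
  RingHom.congr_fun (congrArg CommRingCat.Hom.hom (lineRingHom_app a)) y

theorem bijective_eval₂_p₀_app (a : Fin 2) : Function.Bijective
    (Polynomial.eval₂RingHom (p₀.app (lineOpen a)).hom
      (flagRingHom a (awayC (lineHom (X a.succ)) (X a.rev)))) := by
  have hB : Function.Bijective (lineRingHom a).hom :=
    ConcreteCategory.bijective_of_isIso (lineRingHom a)
  have hS : Function.Bijective (flagRingHom a).hom :=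
    ConcreteCategory.bijective_of_isIso (flagRingHom a)
  have hM : Function.Bijective (Polynomial.mapRingHom (lineRingHom a).hom) :=
    ⟨Polynomial.map_injective _ hB.1, Polynomial.map_surjective _ hB.2⟩
  have h : (Polynomial.eval₂RingHom (p₀.app (lineOpen a)).hom
      (flagRingHom a (awayC (lineHom (X a.succ)) (X a.rev)))).comp
        (Polynomial.mapRingHom (lineRingHom a).hom) =
      (flagRingHom a).hom.comp (Polynomial.eval₂RingHom (flagHom a) (awayC _ (X a.rev))) := by
    apply Polynomial.ringHom_ext
    · intro y
      simpa using app_lineRingHom a y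
    · simp
  rw [← Function.Bijective.of_comp_iff _ hM, ← RingHom.coe_comp, h, RingHom.coe_comp]
  exact hS.comp (bijective_flagEval a)

/-- The lines with `v_{a+1} ≠ 0` are parametrized by the other affine coordinate. -/
def lineChart (a : Fin 2) : LineChart q₀ p₀ (lineOpen a) where
  isAffineOpen := isAffineOpen_lineOpen a
  isAffineOpen_preimage := isAffineOpen_preimage_lineOpen a
  isDomain := (asIso (lineRingHom a)).commRingCatIsoToRingEquiv.symm.toMulEquiv.isDomain _
  τ := flagRingHom a (awayC _ (X a.rev))
  bijective := bijective_eval₂_p₀_app a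
  const c := ⟨lineRingHom a (awayC _ c), by
    rw [app_lineRingHom, pullbackFunction_flagRingHom, flagHom_awayC]⟩
  -- The defaults, intercept `0` and slope `1`, belong to the coordinate `τ` itself.
  intercept := Function.update (fun _ => 0) a (lineRingHom a (-awayX (X_mem_dualGrading _) 0))
  slope := Function.update (fun _ => 1) a
    (lineRingHom a (-awayX (X_mem_dualGrading _) a.rev.succ))
  pullback_X i := by
    by_cases hi : i = a
    · subst hi
      rw [Function.update_self, Function.update_self, app_lineRingHom, app_lineRingHom,
        pullbackFunction_flagRingHom, ← map_mul, ← map_add, ← awayC_X]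
    · obtain rfl : i = a.rev := by
        revert hi; fin_cases a <;> fin_cases i <;> decide
      rw [Function.update_of_ne hi, Function.update_of_ne hi, map_zero, map_one, zero_add, one_mul,
        pullbackFunction_flagRingHom]

end

end RadonPenrose

theorem mainTheorem4 (M : Type) [AddCommGroup M] [Module RadonPenrose.PlaneRing M] [Module ℂ M]
    [IsScalarTower ℂ RadonPenrose.PlaneRing M]
    [Module.Finite RadonPenrose.PlaneRing M] [Module.Projective RadonPenrose.PlaneRing M]
    (r : ℕ) (hr : ∀ x : PrimeSpectrum RadonPenrose.PlaneRing, Module.rankAtStalk M x = r)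
    (ρ : RadonPenrose.EquivariantStructure M) (nabla : RadonPenrose.Connection M)
    (hnabla : nabla.IsEquivariant ρ) :
    RadonPenrose.IsLocallyFreeOfRank (RadonPenrose.radonPenroseTransform nabla) r := by
  -- One global weight basis, ordered by total weight, serves both charts.
  obtain ⟨b, χ, hb⟩ := ρ.exists_basis_isWeight r hr
  intro x
  obtain ⟨a, ha⟩ := RadonPenrose.exists_mem_lineOpen x
  exact ⟨RadonPenrose.lineOpen a, ha, (RadonPenrose.lineChart a).nonempty_restrict_iso_free nabla b
    (fun j => ∑ l, χ j l) fun i k l h => hnabla.weight_lt b χ hb i k l h⟩
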